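/- Let $n\ge 1$ and $\delta\ge 0$. For Schwartz functions $f,g$ on $\mathbb R^n$ put $$S^{\delta}(f,g)(x)=\iint_{|\xi|^2+|\eta|^2\le 1}e^{2\pi i x\cdot(\xi+\eta)}\,(1-|\xi|^2-|\eta|^2)^{\delta}\,\widehat f(\xi)\,\widehat g(\eta)\,d\xi\,d\eta,\qquad \widehat f(\xi)=\int_{\mathbb R^n}e^{-2\pi i x\cdot \xi}f(x)\,dx,$$ and call $S^\delta$ bounded from $L^{p_1}(\mathbb R^n)\times L^{p_2}(\mathbb R^n)$ into $L^p(\mathbb R^n)$ if there is a constant $C$ such that $\|S^\delta(f,g)\|_p\le C\|f\|_{p_1}\|g\|_{p_2}$ for all Schwartz functions $f,g$; otherwise it is called unbounded. Let $1\le p_1,p_2\le\infty$ and $1/p=1/p_1+1/p_2$ (with $1/\infty=0$), so that $0<p\le\infty$. (i) If $\delta>n-\tfrac12$, then $S^\delta$ is bounded from $L^{p_1}(\mathbb R^n)\times L^{p_2}(\mathbb R^n)$ into $L^p(\mathbb R^n)$. Moreover, with the kernel $K_\delta(y,z)=\iint_{|\xi|^2+|\eta|^2\le 1}e^{2\pi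 i (y\cdot\xi+z\cdot\eta)}(1-|\xi|^2-|\eta|^2)^\delta\,d\xi\,d\eta$, the formula $S^\delta(f,g)(x)=\iint K_\delta(x-y,x-z)f(y)g(z)\,dy\,dz$ holds for all $x$ when $f,g$ are integrable ($S^\delta(f,g)$ being given by the same Fourier integral), and for all $f\in L^{p_1}(\mathbb R^n)$, $g\in L^{p_2}(\mathbb R^n)$ its right-hand side converges absolutely for almost every $x$ and defines a function in $L^p(\mathbb R^n)$ whose $L^p$ (quasi-)norm is at most $C\|f\|_{p_1}\|g\|_{p_2}$, with $C$ independent of $f$ and $g$. (ii) If $\delta\le n\big(\tfrac1p-1\big)-\tfrac12$, equivalently $p\le \frac{2n}{2n+2\delta+1}$, then $S^\delta$ is not bounded from $L^{p_1}(\mathbb R^n)\times L^{p_2}(\mathbb R^n)$ into $L^p(\mathbb R^n)$. (iii) For every $1\le p\le\infty$ (here $p$ is no longer tied to $p_1,p_2$) with conjugate exponent $p'$, $1/p+1/p'=1$: if $\delta\le n\big|\tfrac1p-\tfrac12\big|-\tfrac12$, then $S^\delta$ is unbounded from $L^p(\mathbb R^n)\times L^\infty(\mathbb R^n)$ into $L^p(\mathbb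 R^n)$, from $L^\infty(\mathbb R^n)\times L^p(\mathbb R^n)$ into $L^p(\mathbb R^n)$, and from $L^p(\mathbb R^n)\times L^{p'}(\mathbb R^n)$ into $L^1(\mathbb R^n)$. -/

import Mathlib

open MeasureTheory
open scoped FourierTransform SchwartzMap NNReal ENNReal

noncomputable section

namespace BilinearBochnerRiesz

/-- Euclidean space `ℝⁿ`. -/
abbrev Eucl (n : ℕ) : Type := EuclideanSpace ℝ (Fin n)

/-- The set `|ξ|² + |η|² ≤ 1`, i.e. the closed Euclidean unit ball of `ℝⁿ × ℝⁿ = ℝ²ⁿ`. -/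
def unitBall (n : ℕ) : Set (Eucl n × Eucl n) :=
  {ζ | ‖ζ.1‖ ^ 2 + ‖ζ.2‖ ^ 2 ≤ 1}

/-- The bilinear Bochner-Riesz means of order `δ`,
`S^δ(f,g)(x) = ∬_{|ξ|²+|η|² ≤ 1} e^{2πi x·(ξ+η)} (1-|ξ|²-|η|²)^δ f̂(ξ) ĝ(η) dξ dη`,
where `f̂(ξ) = ∫ e^{-2πi x·ξ} f(x) dx`. -/
def bochnerRiesz {n : ℕ} (δ : ℝ) (f g : Eucl n → ℂ) (x : Eucl n) : ℂ :=
  ∫ ζ : Eucl n × Eucl n in unitBall n,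
    Complex.exp (2 * Real.pi * Complex.I * (inner ℝ x (ζ.1 + ζ.2) : ℝ)) *
      ((1 - ‖ζ.1‖ ^ 2 - ‖ζ.2‖ ^ 2) ^ δ : ℝ) * 𝓕 f ζ.1 * 𝓕 g ζ.2

/-- `S^δ`, initially defined on pairs of Schwartz functions, is bounded from `L^{p₁} × L^{p₂}`
into `L^p`: the estimate `‖S^δ(f,g)‖_p ≤ C ‖f‖_{p₁} ‖g‖_{p₂}` holds for all Schwartz functions
`f`, `g` with a constant `C` independent of them. In particular, if this fails then `S^δ` has no
bounded extension to `L^{p₁} × L^{p₂}`. -/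
def IsBoundedOnSchwartz (n : ℕ) (δ : ℝ) (p₁ p₂ p : ℝ≥0∞) : Prop :=
  ∃ C : ℝ≥0, ∀ f g : 𝓢(Eucl n, ℂ),
    eLpNorm (bochnerRiesz δ f g) p volume ≤ C * eLpNorm f p₁ volume * eLpNorm g p₂ volume

/-- The kernel of `S^δ`: the inverse Fourier transform on `ℝ²ⁿ` of the symbol
`(1-|ξ|²-|η|²)₊^δ`. -/
def kernel {n : ℕ} (δ : ℝ) (w : Eucl n × Eucl n) : ℂ :=
  ∫ ζ : Eucl n × Eucl n in unitBall n,
    Complex.exp (2 * Real.pi * Complex.I * (inner ℝ w.1 ζ.1 + inner ℝ w.2 ζ.2 : ℝ)) *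
      ((1 - ‖ζ.1‖ ^ 2 - ‖ζ.2‖ ^ 2) ^ δ : ℝ)

/-- The integrand of the kernel representation of `S^δ(f,g)(x)`. -/
def kernelIntegrand {n : ℕ} (δ : ℝ) (f g : Eucl n → ℂ) (x : Eucl n) (w : Eucl n × Eucl n) : ℂ :=
  kernel δ (x - w.1, x - w.2) * f w.1 * g w.2

/-- The kernel representation `∬ K(x-y, x-z) f(y) g(z) dy dz` of `S^δ(f,g)(x)`. -/
def kernelOp {n : ℕ} (δ : ℝ) (f g : Eucl n → ℂ) (x : Eucl n) : ℂ :=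
  ∫ w : Eucl n × Eucl n, kernelIntegrand δ f g x w

/-- The kernel representation extends `S^δ` to a bounded operator on the whole of
`L^{p₁} × L^{p₂}` with values in `L^p`: it coincides with `S^δ` on integrable functions (so on
Schwartz functions), and for all `f ∈ L^{p₁}`, `g ∈ L^{p₂}` the integral converges absolutely for
almost every `x` and defines a function in `L^p` of norm at most `C ‖f‖_{p₁} ‖g‖_{p₂}`. -/
def HasBoundedKernelExtension (n : ℕ) (δ : ℝ) (p₁ p₂ p : ℝ≥0∞) : Prop :=
  (∀ f g : Eucl n → ℂ, Integrable f volume → Integrable g volume →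
    ∀ x, kernelOp δ f g x = bochnerRiesz δ f g x) ∧
  ∃ C : ℝ≥0, ∀ f g : Eucl n → ℂ, MemLp f p₁ volume → MemLp g p₂ volume →
    (∀ᵐ x, Integrable (kernelIntegrand δ f g x) volume) ∧
    MemLp (kernelOp δ f g) p volume ∧
    eLpNorm (kernelOp δ f g) p volume ≤ C * eLpNorm f p₁ volume * eLpNorm g p₂ volume

end BilinearBochnerRiesz

end

noncomputable section

namespace BilinearBochnerRiesz

open Set Filter Topology

/-! Everything rests on the exact size of Bochner-Riesz kernels. In dimension `N`, rotating `x` onto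
an axis and integrating out the orthogonal variables turns the kernel of `(1-|ξ|²)_+^δ` into a
positive constant times `osc μ (2π|x|)` with `μ = δ + (N-1)/2`. Shifting the contour of `osc` to the
vertical half-lines above `±1` gives `2 s^{-(μ+1)} Im(e^{is} B(s))`, where `B` has a nonzero limit.
This yields the decay `|x|^{-b}` with `b = δ + (N+1)/2` (`exists_norm_ballKernel_le`). It also
yields sharpness on average: the integral of `s^{2μ+1} |osc μ s|²` diverges logarithmically
(`not_integrableOn_osc_sq`). Working with weighted squares avoids discussing the zeros of the
kernel.

(i) `kernel` is a linear Bochner-Riesz kernel in dimension `2n`, so it decays like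
`|(y,z)|^{-(δ+n+1/2)}`. Splitting the decay evenly between `y` and `z` bounds it by a product
`φ(y)φ(z)`, with `φ` integrable as soon as `δ > n - 1/2`. Young's inequality in each factor and
Hölder's inequality (valid also for `p < 1`) finish.

(ii) If the Fourier transforms of `f` and `g` equal 1 on the unit ball, then `S^δ(f,g)(x) =
K_δ(x,x)`. This has size `|x|^{-(δ+n+1/2)}` on average on `ℝⁿ`, so it is not in `L^p` when
`p(δ+n+1/2) ≤ n`.

(iii) In the trilinear form `∫ S^δ(f,g) h`, let the Fourier transform of one function shrink to a
point mass at 0 while its sup norm stays at most 1. With `g` chosen so, the linear multiplier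
`(1-|ξ|²)_+^δ` on `L^p` remains; with `h` chosen so, `(1-2|ξ|²)_+^δ` remains. Such multipliers are
unbounded in the stated range: fixing `f` with Fourier transform 1 on the unit ball leaves
integration against the kernel, which is not bounded on the dual space, as truncations of the
conjugate kernel times the critical weight show (`not_exists_bound_integral_ballKernel_mul`). -/

/-! ### The truncated power. -/

/-- The truncated power `(1 - t)_+^δ`, with value `0` for `t > 1` also when `δ = 0`. -/
def ballSymbol (δ t : ℝ) : ℝ := if t ≤ 1 then (1 - t) ^ δ else 0

lemma ballSymbol_of_le {δ t : ℝ} (ht : t ≤ 1) : ballSymbol δ t = (1 - t) ^ δ := if_pos ht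

lemma ballSymbol_of_lt {δ t : ℝ} (ht : 1 < t) : ballSymbol δ t = 0 := if_neg ht.not_ge

lemma ballSymbol_nonneg (δ t : ℝ) : 0 ≤ ballSymbol δ t := by
  unfold ballSymbol
  split_ifs with h
  · exact Real.rpow_nonneg (by linarith) _
  · exact le_rfl

lemma ballSymbol_le_one {δ t : ℝ} (hδ : 0 ≤ δ) (ht : 0 ≤ t) : ballSymbol δ t ≤ 1 := by
  unfold ballSymbol
  split_ifs with h
  · exact Real.rpow_le_one (by linarith) (by linarith) hδ
  · exact zero_le_one

@[fun_prop]
lemma measurable_ballSymbol (δ : ℝ) : Measurable (ballSymbol δ) := by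
  unfold ballSymbol
  exact Measurable.ite measurableSet_Iic (by fun_prop) measurable_const

lemma continuousAt_ballSymbol {δ t : ℝ} (ht : t ≠ 1) : ContinuousAt (ballSymbol δ) t := by
  rcases lt_or_gt_of_ne ht with h | h
  · have : ballSymbol δ =ᶠ[𝓝 t] fun u => (1 - u) ^ δ := by
      filter_upwards [Iio_mem_nhds h] with u hu using ballSymbol_of_le (le_of_lt hu)
    refine ContinuousAt.congr ?_ this.symm
    exact (continuousAt_const.sub continuousAt_id).rpow_const
      (Or.inl (sub_ne_zero.2 (by simpa using h.ne')))
  · have : ballSymbol δ =ᶠ[𝓝 t] fun _ => 0 := by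
      filter_upwards [Ioi_mem_nhds h] with u hu using ballSymbol_of_lt hu
    exact continuousAt_const.congr this.symm

/-! ### Contour shift for the oscillatory integral. -/

/-- The one-dimensional oscillatory integral `∫_{-1}^{1} e^{ist} (1-t²)^μ dt`. -/
def osc (μ s : ℝ) : ℂ :=
  ∫ t : ℝ, Complex.exp (Complex.I * s * t) * (ballSymbol μ (t ^ 2) : ℝ)

lemma osc_eq_intervalIntegral (μ s : ℝ) :
    osc μ s = ∫ t : ℝ in (-1)..1,
      Complex.exp (Complex.I * s * t) * ((1 - t ^ 2) ^ μ : ℝ) := by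
  rw [osc, intervalIntegral.integral_of_le (by norm_num), ← integral_Icc_eq_integral_Ioc,
    ← integral_indicator measurableSet_Icc]
  refine integral_congr_ae (Eventually.of_forall fun t => ?_)
  by_cases ht : t ∈ Icc (-1 : ℝ) 1
  · rw [indicator_of_mem ht]
    simp only
    rw [ballSymbol_of_le (by nlinarith [ht.1, ht.2])]
  · rw [indicator_of_notMem ht]
    simp only
    rw [ballSymbol_of_lt]
    · simp
    · by_contra! h
      exact ht (by constructor <;> nlinarith)

lemma ofReal_mul_cpow {r : ℝ} (hr : 0 < r) {z : ℂ} (hz : z ≠ 0) (μ : ℝ) :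
    ((r : ℂ) * z) ^ (μ : ℂ) = (r ^ μ : ℝ) * z ^ (μ : ℂ) := by
  have hr' : (r : ℂ) ≠ 0 := by exact_mod_cast hr.ne'
  rw [Complex.cpow_def_of_ne_zero (mul_ne_zero hr' hz), Complex.log_ofReal_mul hr hz, add_mul,
    Complex.exp_add, Complex.cpow_def_of_ne_zero hz, Real.rpow_def_of_pos hr]
  push_cast
  rfl

lemma continuousAt_cpow_of_re_nonneg {μ : ℝ} (hμ : 0 ≤ μ) {z : ℂ} (hz : 0 ≤ z.re) :
    ContinuousAt (fun z : ℂ => z ^ (μ : ℂ)) z := by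
  rcases hμ.eq_or_lt with rfl | h
  · simpa using continuousAt_const
  · exact Complex.continuousAt_cpow_const_of_re_pos (Or.inl hz) (by simpa using h)

/-- The holomorphic extension of `e^{ist} (1-t²)^μ` to the strip `|Re z| < 1`. -/
def oscExt (μ s : ℝ) (z : ℂ) : ℂ :=
  Complex.exp (Complex.I * s * z) * (1 - z) ^ (μ : ℂ) * (1 + z) ^ (μ : ℂ)

/-- On the closed strip `1 - z` and `1 + z` have nonnegative real part, so the principal powers stay
off the branch cut. At the branch points `±1` continuity uses `μ ≥ 0`. -/
lemma continuousAt_oscExt {μ : ℝ} (hμ : 0 ≤ μ) (s : ℝ) {z : ℂ} (h1 : -1 ≤ z.re) (h2 : z.re ≤ 1) :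
    ContinuousAt (oscExt μ s) z := by
  unfold oscExt
  refine ((by fun_prop : ContinuousAt (fun z => Complex.exp (Complex.I * s * z)) z).mul ?_).mul ?_
  · exact ContinuousAt.comp (f := fun z : ℂ => 1 - z) (g := fun z : ℂ => z ^ (μ : ℂ))
      (continuousAt_cpow_of_re_nonneg hμ (by simpa using h2)) (by fun_prop)
  · exact ContinuousAt.comp (f := fun z : ℂ => 1 + z) (g := fun z : ℂ => z ^ (μ : ℂ))
      (continuousAt_cpow_of_re_nonneg hμ (by simp; linarith)) (by fun_prop)

lemma differentiableAt_oscExt (μ s : ℝ) {z : ℂ} (h1 : -1 < z.re) (h2 : z.re < 1) :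
    DifferentiableAt ℂ (oscExt μ s) z := by
  unfold oscExt
  refine ((by fun_prop : DifferentiableAt ℂ (fun z => Complex.exp (Complex.I * s * z)) z).mul
    ?_).mul ?_
  · exact (by fun_prop : DifferentiableAt ℂ (fun z : ℂ => 1 - z) z).cpow_const
      (Or.inl (by simpa using h2))
  · exact (by fun_prop : DifferentiableAt ℂ (fun z : ℂ => 1 + z) z).cpow_const
      (Or.inl (by simp; linarith))

lemma oscExt_ofReal (μ s : ℝ) {t : ℝ} (ht : t ∈ Icc (-1 : ℝ) 1) :
    oscExt μ s t = Complex.exp (Complex.I * s * t) * ((1 - t ^ 2) ^ μ : ℝ) := by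
  have h1 : 0 ≤ 1 - t := by linarith [ht.2]
  have h2 : 0 ≤ 1 + t := by linarith [ht.1]
  rw [oscExt, show (1 : ℝ) - t ^ 2 = (1 - t) * (1 + t) by ring, Real.mul_rpow h1 h2,
    Complex.ofReal_mul, Complex.ofReal_cpow h1, Complex.ofReal_cpow h2]
  push_cast
  ring

lemma norm_oscExt_le {μ : ℝ} (hμ : 0 ≤ μ) (s : ℝ) {x y : ℝ} (hx : x ∈ Icc (-1 : ℝ) 1)
    (hy : 0 ≤ y) :
    ‖oscExt μ s (x + y * Complex.I)‖ ≤ Real.exp (-s * y) * (2 + y) ^ (2 * μ) := by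
  have key : ∀ a : ℝ, |a| ≤ 2 → ∀ b : ℝ, |b| = y →
      ‖((a : ℂ) + b * Complex.I) ^ (μ : ℂ)‖ ≤ (2 + y) ^ μ := by
    intro a ha b hb
    rw [Complex.norm_cpow_real]
    refine Real.rpow_le_rpow (norm_nonneg _) ((norm_add_le _ _).trans ?_) hμ
    simpa [hb] using ha
  have e1 : (1 : ℂ) - (x + y * Complex.I) = ((1 - x : ℝ) : ℂ) + ((-y : ℝ) : ℂ) * Complex.I := by
    push_cast; ring
  have e2 : (1 : ℂ) + (x + y * Complex.I) = ((1 + x : ℝ) : ℂ) + (y : ℂ) * Complex.I := by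
    push_cast; ring
  rw [oscExt, norm_mul, norm_mul, Complex.norm_exp, e1, e2, mul_assoc, two_mul,
    Real.rpow_add (by linarith)]
  have e3 : (Complex.I * s * (x + y * Complex.I)).re = -s * y := by simp
  rw [e3]
  gcongr
  · exact key _ (abs_le.2 ⟨by linarith [hx.2], by linarith [hx.1]⟩) _ (by simp [abs_of_nonneg hy])
  · exact key _ (abs_le.2 ⟨by linarith [hx.1], by linarith [hx.2]⟩) _ (abs_of_nonneg hy)

lemma tendsto_exp_neg_mul_two_add_rpow (ν : ℝ) {s : ℝ} (hs : 0 < s) :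
    Tendsto (fun y : ℝ => Real.exp (-s * y) * (2 + y) ^ ν) atTop (𝓝 0) := by
  have h := (tendsto_rpow_mul_exp_neg_mul_atTop_nhds_zero ν s hs).comp
    (tendsto_atTop_add_const_left atTop (2 : ℝ) tendsto_id)
  have h2 := h.mul_const (Real.exp (2 * s))
  rw [zero_mul] at h2
  refine h2.congr fun y => ?_
  simp only [Function.comp, id]
  rw [mul_assoc, ← Real.exp_add, mul_comm]
  ring_nf

lemma integrableOn_exp_neg_mul_two_add_rpow (ν : ℝ) {s : ℝ} (hs : 0 < s) :
    IntegrableOn (fun y : ℝ => Real.exp (-s * y) * (2 + y) ^ ν) (Ioi 0) := by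
  refine integrable_of_isBigO_exp_neg (b := s / 2) (by positivity) ?_ ?_
  · intro y hy
    have hy : 0 ≤ y := hy
    refine ContinuousAt.continuousWithinAt ?_
    refine ContinuousAt.mul (by fun_prop) (ContinuousAt.rpow_const (by fun_prop) (Or.inl ?_))
    linarith
  · have h := (tendsto_exp_neg_mul_two_add_rpow ν (half_pos hs)).isBigO_one ℝ
    have h2 := h.mul (Asymptotics.isBigO_refl (fun y : ℝ => Real.exp (-(s / 2) * y)) atTop)
    refine (h2.congr_left fun y => ?_).congr_right fun y => by simp
    rw [mul_right_comm, ← Real.exp_add]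
    ring_nf

lemma continuous_oscExt_vertical {μ : ℝ} (hμ : 0 ≤ μ) (s : ℝ) {x : ℝ}
    (hx : x ∈ Icc (-1 : ℝ) 1) : Continuous (fun y : ℝ => oscExt μ s (x + y * Complex.I)) := by
  rw [continuous_iff_continuousAt]
  intro y
  exact ContinuousAt.comp (f := fun y : ℝ => (x + y * Complex.I : ℂ)) (g := oscExt μ s)
    (continuousAt_oscExt hμ s (by simpa using hx.1) (by simpa using hx.2)) (by fun_prop)

lemma integrableOn_oscExt_vertical {μ : ℝ} (hμ : 0 ≤ μ) {s : ℝ} (hs : 0 < s) {x : ℝ}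
    (hx : x ∈ Icc (-1 : ℝ) 1) :
    IntegrableOn (fun y : ℝ => oscExt μ s (x + y * Complex.I)) (Ioi 0) := by
  refine (integrableOn_exp_neg_mul_two_add_rpow (2 * μ) hs).mono'
    (continuous_oscExt_vertical hμ s hx).aestronglyMeasurable ?_
  refine (ae_restrict_iff' measurableSet_Ioi).2 (Eventually.of_forall fun y hy => ?_)
  exact norm_oscExt_le hμ s hx (le_of_lt hy)

/-- Cauchy's theorem on the rectangle over `[-1, 1]` of height `H`. As `H → ∞` the top side
vanishes, because `e^{-sH}` beats the polynomial growth of the powers. -/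
lemma osc_eq_vertical {μ : ℝ} (hμ : 0 ≤ μ) {s : ℝ} (hs : 0 < s) :
    osc μ s = Complex.I * (∫ y : ℝ in Ioi 0, oscExt μ s ((-1 : ℝ) + y * Complex.I)) -
      Complex.I * (∫ y : ℝ in Ioi 0, oscExt μ s ((1 : ℝ) + y * Complex.I)) := by
  have hrect : ∀ H : ℝ, 0 ≤ H →
      osc μ s - (∫ x : ℝ in (-1)..1, oscExt μ s (x + H * Complex.I)) +
      Complex.I * (∫ y : ℝ in (0)..H, oscExt μ s ((1 : ℝ) + y * Complex.I)) -
      Complex.I * (∫ y : ℝ in (0)..H, oscExt μ s ((-1 : ℝ) + y * Complex.I)) = 0 := by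
    intro H hH
    have := Complex.integral_boundary_rect_eq_zero_of_continuousOn_of_differentiableOn
      (oscExt μ s) (-1) (1 + H * Complex.I) ?_ ?_
    · simp only [Complex.neg_re, Complex.one_re, Complex.add_re, Complex.mul_re, Complex.ofReal_re,
        Complex.I_re, Complex.ofReal_im, Complex.I_im, Complex.neg_im, Complex.one_im,
        Complex.add_im, Complex.mul_im, smul_eq_mul, mul_zero, mul_one, sub_zero, add_zero,
        zero_mul, zero_add, neg_zero, Complex.ofReal_zero] at this
      rw [← this, osc_eq_intervalIntegral]
      congr 3
      refine intervalIntegral.integral_congr fun t ht => ?_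
      rw [uIcc_of_le (by norm_num)] at ht
      exact (oscExt_ofReal μ s ht).symm
    · intro z hz
      have hz := hz.1
      simp only [Complex.neg_re, Complex.one_re, Complex.add_re, Complex.mul_re, Complex.ofReal_re,
        Complex.I_re, Complex.ofReal_im, Complex.I_im, mul_zero, mul_one, sub_zero, add_zero,
        mem_preimage, uIcc_of_le (show (-1 : ℝ) ≤ 1 by norm_num)] at hz
      exact (continuousAt_oscExt hμ s hz.1 hz.2).continuousWithinAt
    · intro z hz
      have hz := hz.1
      simp only [Complex.neg_re, Complex.one_re, Complex.add_re, Complex.mul_re, Complex.ofReal_re,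
        Complex.I_re, Complex.ofReal_im, Complex.I_im, mul_zero, mul_one, sub_zero, add_zero,
        mem_preimage] at hz
      norm_num at hz
      exact (differentiableAt_oscExt μ s hz.1 hz.2).differentiableWithinAt
  have htop : Tendsto (fun H : ℝ => ∫ x : ℝ in (-1)..1, oscExt μ s (x + H * Complex.I)) atTop
      (𝓝 0) := by
    have h0 := (tendsto_exp_neg_mul_two_add_rpow (2 * μ) hs).mul_const |(1 : ℝ) - (-1)|
    rw [zero_mul] at h0
    refine squeeze_zero_norm' ?_ h0
    filter_upwards [eventually_ge_atTop 0] with H hH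
    refine intervalIntegral.norm_integral_le_of_norm_le_const fun x hx => ?_
    rw [uIoc_of_le (by norm_num)] at hx
    exact norm_oscExt_le hμ s ⟨hx.1.le, hx.2⟩ hH
  have hr := intervalIntegral_tendsto_integral_Ioi 0
    (integrableOn_oscExt_vertical hμ hs (x := 1) (by simp)) tendsto_id
  have hl := intervalIntegral_tendsto_integral_Ioi 0
    (integrableOn_oscExt_vertical hμ hs (x := -1) (by simp)) tendsto_id
  have hlim := ((tendsto_const_nhds (x := osc μ s)).sub htop).add (hr.const_mul Complex.I)
  have hlim := hlim.sub (hl.const_mul Complex.I)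
  have hz := tendsto_nhds_unique (hlim.congr' (f₂ := fun _ => 0) (by
    filter_upwards [eventually_ge_atTop 0] with H hH using hrect H hH)) tendsto_const_nhds
  linear_combination hz

/-! ### Size of the oscillatory integral. -/

/-- The amplitude in the asymptotic formula for `osc`. -/
def oscAmp (μ s : ℝ) : ℂ :=
  ∫ v : ℝ in Ioi 0, ((Real.exp (-v) * v ^ μ : ℝ) : ℂ) * (2 + (v / s : ℝ) * Complex.I) ^ (μ : ℂ)

/-- The substitution `v = s y`: above the endpoint `1 - z = -iy`, so `y^μ dy` produces the factor
`s^{-(μ+1)}`. -/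
lemma integral_oscExt_right (μ : ℝ) {s : ℝ} (hs : 0 < s) :
    ∫ y : ℝ in Ioi 0, oscExt μ s ((1 : ℝ) + y * Complex.I) =
      Complex.exp (Complex.I * s) * (-Complex.I) ^ (μ : ℂ) * (s ^ (-(μ + 1)) : ℝ) *
        oscAmp μ s := by
  have hsub := integral_comp_mul_left_Ioi (fun v : ℝ =>
    ((Real.exp (-v) * v ^ μ : ℝ) : ℂ) * (2 + (v / s : ℝ) * Complex.I) ^ (μ : ℂ)) 0 hs
  rw [mul_zero] at hsub
  have h1 : oscAmp μ s = s • ∫ y : ℝ in Ioi 0,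
      ((Real.exp (-(s * y)) * (s * y) ^ μ : ℝ) : ℂ) *
        (2 + (s * y / s : ℝ) * Complex.I) ^ (μ : ℂ) := by
    rw [hsub, smul_smul, mul_inv_cancel₀ hs.ne', one_smul, oscAmp]
  rw [h1, Complex.real_smul, ← mul_assoc, ← integral_const_mul]
  refine setIntegral_congr_fun measurableSet_Ioi fun y hy => ?_
  have hy : 0 < y := hy
  have e1 : (1 : ℂ) - (((1 : ℝ) : ℂ) + y * Complex.I) = (y : ℂ) * (-Complex.I) := by
    push_cast; ring
  have e2 : (1 : ℂ) + (((1 : ℝ) : ℂ) + y * Complex.I) = 2 + y * Complex.I := by push_cast; ring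
  have e3 : Complex.exp (Complex.I * s * (((1 : ℝ) : ℂ) + y * Complex.I)) =
      Complex.exp (Complex.I * s) * (Real.exp (-(s * y)) : ℝ) := by
    rw [Complex.ofReal_exp, ← Complex.exp_add]
    congr 1
    push_cast
    linear_combination (s * y : ℂ) * Complex.I_sq
  have e4 : s ^ (-(μ + 1)) * s * s ^ μ = 1 := by
    rw [Real.rpow_neg hs.le, Real.rpow_add hs, Real.rpow_one]
    field_simp
  have e4' : ((s ^ (-(μ + 1)) : ℝ) : ℂ) * s * ((s ^ μ : ℝ) : ℂ) = 1 := by exact_mod_cast e4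
  rw [oscExt, e1, e2, e3, ofReal_mul_cpow hy (by simp), mul_div_cancel_left₀ _ hs.ne',
    Real.mul_rpow hs.le hy.le, Complex.ofReal_mul, Complex.ofReal_mul]
  linear_combination (-Complex.exp (Complex.I * s) * (Real.exp (-(s * y)) : ℝ) *
    ((y ^ μ : ℝ) * (-Complex.I) ^ (μ : ℂ)) * (2 + y * Complex.I) ^ (μ : ℂ)) * e4'

/-- Reflection symmetry under `z ↦ -conj z`. Conjugation commutes with the principal powers since
the bases have nonnegative real part, hence argument different from `π`. -/
lemma oscExt_left (μ s y : ℝ) :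
    oscExt μ s ((-1 : ℝ) + y * Complex.I) =
      (starRingEnd ℂ) (oscExt μ s ((1 : ℝ) + y * Complex.I)) := by
  have hc : ∀ z : ℂ, z.arg ≠ Real.pi →
      (starRingEnd ℂ) (z ^ (μ : ℂ)) = ((starRingEnd ℂ) z) ^ (μ : ℂ) := by
    intro z hz
    rw [Complex.conj_cpow _ _ hz, Complex.conj_ofReal]
  have harg : ∀ z : ℂ, 0 ≤ z.re → z.arg ≠ Real.pi := by
    intro z hz h
    exact absurd (Complex.arg_eq_pi_iff.1 h).1 (not_lt.2 hz)
  rw [oscExt, oscExt, map_mul, map_mul, hc _ (harg _ (by simp)),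
    hc _ (harg _ (by simp)), ← Complex.exp_conj]
  have e1 : (1 : ℂ) - ((-1 : ℝ) + y * Complex.I) =
      (starRingEnd ℂ) (1 + ((1 : ℝ) + y * Complex.I)) := by
    simp; ring
  have e2 : (1 : ℂ) + ((-1 : ℝ) + y * Complex.I) =
      (starRingEnd ℂ) (1 - ((1 : ℝ) + y * Complex.I)) := by
    simp
  have e3 : Complex.I * s * ((-1 : ℝ) + y * Complex.I) =
      (starRingEnd ℂ) (Complex.I * s * ((1 : ℝ) + y * Complex.I)) := by
    simp; ring
  rw [← e1, ← e2, ← e3]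
  ring

lemma osc_eq_im {μ : ℝ} (hμ : 0 ≤ μ) {s : ℝ} (hs : 0 < s) :
    osc μ s = ((2 * s ^ (-(μ + 1)) *
      (Complex.exp (Complex.I * s) * ((-Complex.I) ^ (μ : ℂ) * oscAmp μ s)).im : ℝ) : ℂ) := by
  have hconj : ∫ y : ℝ in Ioi 0, oscExt μ s ((-1 : ℝ) + y * Complex.I) =
      (starRingEnd ℂ) (∫ y : ℝ in Ioi 0, oscExt μ s ((1 : ℝ) + y * Complex.I)) := by
    rw [← integral_conj]
    exact setIntegral_congr_fun measurableSet_Ioi fun y _ => oscExt_left μ s y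
  rw [osc_eq_vertical hμ hs, hconj, ← mul_sub, ← neg_sub, Complex.sub_conj,
    integral_oscExt_right μ hs]
  have e : Complex.exp (Complex.I * s) * (-Complex.I) ^ (μ : ℂ) * (s ^ (-(μ + 1)) : ℝ) *
      oscAmp μ s = (s ^ (-(μ + 1)) : ℝ) *
        (Complex.exp (Complex.I * s) * ((-Complex.I) ^ (μ : ℂ) * oscAmp μ s)) := by ring
  rw [e, Complex.im_ofReal_mul, Complex.ofReal_mul, Complex.ofReal_mul, Complex.ofReal_mul,
    Complex.ofReal_mul, Complex.ofReal_ofNat]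
  linear_combination (-2 * ((s ^ (-(μ + 1)) : ℝ) : ℂ) *
    ((Complex.exp (Complex.I * s) * ((-Complex.I) ^ (μ : ℂ) * oscAmp μ s)).im : ℂ)) * Complex.I_sq


lemma norm_oscAmp_integrand_le {μ : ℝ} (hμ : 0 ≤ μ) {s : ℝ} (hs : 1 ≤ s) {v : ℝ} (hv : 0 < v) :
    ‖((Real.exp (-v) * v ^ μ : ℝ) : ℂ) * (2 + (v / s : ℝ) * Complex.I) ^ (μ : ℂ)‖ ≤
      Real.exp (-1 * v) * (2 + v) ^ (2 * μ) := by
  have h0 : 0 ≤ v / s := by positivity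
  have h1 : v / s ≤ v := div_le_self hv.le hs
  have h2 : ‖(2 : ℂ) + (v / s : ℝ) * Complex.I‖ ≤ 2 + v := by
    refine (norm_add_le _ _).trans ?_
    rw [norm_mul, Complex.norm_real, Complex.norm_I, mul_one, Real.norm_of_nonneg h0]
    simpa using h1
  rw [norm_mul, Complex.norm_real, Complex.norm_cpow_real, Real.norm_of_nonneg (by positivity),
    two_mul, Real.rpow_add (by linarith), neg_one_mul, mul_assoc]
  gcongr
  linarith

lemma aestronglyMeasurable_oscAmp_integrand (μ s : ℝ) :
    AEStronglyMeasurable (fun v : ℝ => ((Real.exp (-v) * v ^ μ : ℝ) : ℂ) *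
      (2 + (v / s : ℝ) * Complex.I) ^ (μ : ℂ)) (volume.restrict (Ioi 0)) :=
  Measurable.aestronglyMeasurable (by fun_prop)

lemma exists_norm_oscAmp_le {μ : ℝ} (hμ : 0 ≤ μ) :
    ∃ M : ℝ, ∀ s : ℝ, 1 ≤ s → ‖oscAmp μ s‖ ≤ M := by
  refine ⟨∫ v : ℝ in Ioi 0, Real.exp (-1 * v) * (2 + v) ^ (2 * μ), fun s hs => ?_⟩
  refine norm_integral_le_of_norm_le (integrableOn_exp_neg_mul_two_add_rpow _ one_pos) ?_
  exact (ae_restrict_iff' measurableSet_Ioi).2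
    (Eventually.of_forall fun v hv => norm_oscAmp_integrand_le hμ hs hv)

/-- Dominated convergence as `v / s → 0`. What matters later is that the limit is not zero. -/
lemma tendsto_oscAmp {μ : ℝ} (hμ : 0 ≤ μ) :
    Tendsto (oscAmp μ) atTop (𝓝 ((2 ^ μ * Real.Gamma (μ + 1) : ℝ) : ℂ)) := by
  have hlim : ((2 ^ μ * Real.Gamma (μ + 1) : ℝ) : ℂ) =
      ∫ v : ℝ in Ioi 0, ((Real.exp (-v) * v ^ μ : ℝ) : ℂ) * ((2 : ℂ) ^ (μ : ℂ)) := by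
    rw [integral_mul_const, integral_complex_ofReal, Real.Gamma_eq_integral (by linarith)]
    simp only [add_sub_cancel_right]
    rw [Complex.ofReal_mul, Complex.ofReal_cpow (by norm_num), mul_comm]
    norm_num
  rw [hlim]
  refine tendsto_integral_filter_of_dominated_convergence
    (fun v => Real.exp (-1 * v) * (2 + v) ^ (2 * μ))
    (Eventually.of_forall fun s => aestronglyMeasurable_oscAmp_integrand μ s) ?_
    (integrableOn_exp_neg_mul_two_add_rpow _ one_pos) ?_
  · filter_upwards [eventually_ge_atTop 1] with s hs
    exact (ae_restrict_iff' measurableSet_Ioi).2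
      (Eventually.of_forall fun v hv => norm_oscAmp_integrand_le hμ hs hv)
  · refine Eventually.of_forall fun v => Tendsto.const_mul _ ?_
    have h1 : Tendsto (fun s : ℝ => (2 : ℂ) + (v / s : ℝ) * Complex.I) atTop (𝓝 2) := by
      have h2 : Tendsto (fun s : ℝ => ((v / s : ℝ) : ℂ)) atTop (𝓝 ((0 : ℝ) : ℂ)) :=
        (Complex.continuous_ofReal.tendsto 0).comp (tendsto_const_nhds.div_atTop tendsto_id)
      simpa using (h2.mul_const Complex.I).const_add 2
    exact (continuousAt_cpow_of_re_nonneg hμ (z := 2) (by norm_num)).tendsto.comp h1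

/-- The decay `s^{-(μ+1)}` of the oscillatory integral. -/
lemma exists_norm_osc_le {μ : ℝ} (hμ : 0 ≤ μ) :
    ∃ C : ℝ, 0 < C ∧ ∀ s : ℝ, 0 ≤ s → ‖osc μ s‖ ≤ C * (1 + s) ^ (-(μ + 1)) := by
  obtain ⟨M, hM⟩ := exists_norm_oscAmp_le hμ
  have hM0 : 0 ≤ M := (norm_nonneg _).trans (hM 1 le_rfl)
  -- The `2` is the trivial bound for `s ≤ 1`, `2 * M` comes from the amplitude for `s ≥ 1`, and `2
  -- ^ (μ + 1)` from replacing `s` by `(1 + s) / 2`.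
  refine ⟨(2 + 2 * M) * 2 ^ (μ + 1), by positivity, fun s hs => ?_⟩
  have h2 : ((1 + s) / 2) ^ (-(μ + 1)) = 2 ^ (μ + 1) * (1 + s) ^ (-(μ + 1)) := by
    rw [Real.div_rpow (by linarith) (by norm_num), Real.rpow_neg (by norm_num : (0 : ℝ) ≤ 2),
      div_inv_eq_mul, mul_comm]
  rw [mul_assoc, ← h2]
  have hpos : 0 < (1 + s) / 2 := by linarith
  rcases le_total s 1 with h | h
  · have h3 : ‖osc μ s‖ ≤ 2 := by
      rw [osc_eq_intervalIntegral]
      have := intervalIntegral.norm_integral_le_of_norm_le_const (a := (-1 : ℝ)) (b := 1) (C := 1)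
        (f := fun t : ℝ => Complex.exp (Complex.I * s * t) * ((1 - t ^ 2) ^ μ : ℝ))
        (fun t ht => by
          rw [uIoc_of_le (by norm_num)] at ht
          have h1 : 0 ≤ 1 - t ^ 2 := by nlinarith [ht.1, ht.2]
          rw [norm_mul, Complex.norm_real, Real.norm_of_nonneg (Real.rpow_nonneg h1 _),
            Complex.norm_exp]
          simpa using Real.rpow_le_one h1 (by nlinarith) hμ)
      norm_num at this
      exact_mod_cast this
    have h4 : 1 ≤ ((1 + s) / 2) ^ (-(μ + 1)) :=
      Real.one_le_rpow_of_pos_of_le_one_of_nonpos hpos (by linarith) (by linarith)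
    nlinarith
  · have hs0 : 0 < s := by linarith
    rw [osc_eq_im hμ hs0, Complex.norm_real, norm_mul, norm_mul, Real.norm_of_nonneg zero_le_two,
      Real.norm_of_nonneg (Real.rpow_nonneg hs _)]
    have h5 : ‖(Complex.exp (Complex.I * s) * ((-Complex.I) ^ (μ : ℂ) * oscAmp μ s)).im‖ ≤ M := by
      refine (Complex.abs_im_le_norm _).trans ?_
      rw [norm_mul, norm_mul, Complex.norm_cpow_real, norm_neg, Complex.norm_I, Real.one_rpow,
        one_mul, mul_comm Complex.I, Complex.norm_exp_ofReal_mul_I, one_mul]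
      exact hM s h
    have h6 : s ^ (-(μ + 1)) ≤ ((1 + s) / 2) ^ (-(μ + 1)) :=
      Real.rpow_le_rpow_of_nonpos hpos (by linarith) (by linarith)
    calc 2 * s ^ (-(μ + 1)) * _ ≤ 2 * ((1 + s) / 2) ^ (-(μ + 1)) * M := by gcongr
      _ ≤ _ := by nlinarith [Real.rpow_nonneg hpos.le (-(μ + 1))]

/-- The decay rate `s^{-(μ+1)}` is attained on average: the weighted square integral diverges. -/
lemma not_integrableOn_osc_sq {μ : ℝ} (hμ : 0 ≤ μ) (R : ℝ) :
    ¬ IntegrableOn (fun s : ℝ => s ^ (2 * μ + 1) * ‖osc μ s‖ ^ 2) (Ioi R) := by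
  intro hinteg
  set B : ℝ → ℂ := fun s => (-Complex.I) ^ (μ : ℂ) * oscAmp μ s with hB
  set b : ℝ := 2 ^ μ * Real.Gamma (μ + 1) with hb
  have hbpos : 0 < b := mul_pos (by positivity) (Real.Gamma_pos_of_pos (by linarith))
  have hBlim : Tendsto B atTop (𝓝 ((-Complex.I) ^ (μ : ℂ) * (b : ℂ))) :=
    (tendsto_oscAmp hμ).const_mul _
  have hBnorm : Tendsto (fun s => ‖B s‖) atTop (𝓝 b) := by
    have := hBlim.norm
    rwa [norm_mul, Complex.norm_cpow_real, norm_neg, Complex.norm_I, Real.one_rpow, one_mul,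
      Complex.norm_real, Real.norm_of_nonneg hbpos.le] at this
  have hshift : Tendsto (fun s : ℝ => s + Real.pi / 2) atTop atTop :=
    tendsto_atTop_add_const_right _ _ tendsto_id
  -- A shift by `π/2` multiplies `e^{is}` by `i` and hardly changes `B`. So `u s` and `u (s + π/2)`
  -- are nearly the imaginary and real parts of one number of modulus close to `b`, and cannot both
  -- be small.
  have hdiff : Tendsto (fun s => ‖B (s + Real.pi / 2) - B s‖) atTop (𝓝 0) := by
    have := ((hBlim.comp hshift).sub hBlim).norm
    simpa using this
  set u : ℝ → ℝ := fun s => (Complex.exp (Complex.I * s) * B s).im with hu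
  have hform : ∀ s : ℝ, 0 < s → s ^ (2 * μ + 1) * ‖osc μ s‖ ^ 2 = 4 * (u s ^ 2 / s) := by
    intro s hs
    rw [osc_eq_im hμ hs, Complex.norm_real, Real.norm_eq_abs, sq_abs, mul_pow, mul_pow,
      ← Real.rpow_natCast (s ^ (-(μ + 1))), ← Real.rpow_mul hs.le]
    have : s ^ (2 * μ + 1) * s ^ (-(μ + 1) * ((2 : ℕ) : ℝ)) = s⁻¹ := by
      rw [← Real.rpow_add hs, ← Real.rpow_neg_one]
      congr 1
      push_cast
      ring
    linear_combination (4 * u s ^ 2) * this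
  have hev : ∀ᶠ s in atTop, b ^ 2 / 8 ≤ u s ^ 2 + u (s + Real.pi / 2) ^ 2 := by
    filter_upwards [hBnorm.eventually (lt_mem_nhds (show 3 / 4 * b < b by linarith)),
      hdiff.eventually (gt_mem_nhds (show 0 < b / 4 by linarith))] with s h1 h2
    set z := Complex.exp (Complex.I * s) * B s
    set e := (Complex.exp (Complex.I * s) * (B (s + Real.pi / 2) - B s)).re
    have hexp : ‖Complex.exp (Complex.I * s)‖ = 1 := by
      rw [mul_comm, Complex.norm_exp_ofReal_mul_I]
    have hz : ‖z‖ = ‖B s‖ := by rw [norm_mul, hexp, one_mul]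
    have he : |e| < b / 4 := by
      refine (Complex.abs_re_le_norm _).trans_lt ?_
      rwa [norm_mul, hexp, one_mul]
    have hu2 : u (s + Real.pi / 2) = z.re + e := by
      have : Complex.exp (Complex.I * ((s + Real.pi / 2 : ℝ) : ℂ)) =
          Complex.I * Complex.exp (Complex.I * s) := by
        push_cast
        rw [mul_add, Complex.exp_add, mul_comm Complex.I (_ / 2), Complex.exp_pi_div_two_mul_I,
          mul_comm]
      rw [hu]
      simp only
      rw [this, mul_assoc, Complex.I_mul_im, ← Complex.add_re, ← mul_add, add_sub_cancel]
    have hzz : z.re ^ 2 + z.im ^ 2 = ‖z‖ ^ 2 := by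
      rw [Complex.sq_norm, Complex.normSq_apply]; ring
    rw [hu2, show u s = z.im from rfl]
    have he2 : e ^ 2 ≤ (b / 4) ^ 2 := sq_le_sq' (by linarith [abs_lt.1 he]) (abs_lt.1 he).2.le
    have hz2 : (3 / 4 * b) ^ 2 ≤ ‖z‖ ^ 2 := by
      rw [hz]
      exact pow_le_pow_left₀ (by positivity) h1.le 2
    -- Since `(x+e)² ≥ x²/2 - e²`, the sum is at least `‖z‖²/2 - e² ≥ 9b²/32 - b²/16 ≥ b²/8`.
    nlinarith [sq_nonneg (z.re + 2 * e), sq_nonneg z.im]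
  obtain ⟨S, hS⟩ := eventually_atTop.1 (hev.and
    ((eventually_ge_atTop (2 : ℝ)).and (eventually_ge_atTop R)))
  have hS2 := (hS S le_rfl).2.1
  have hSR := (hS S le_rfl).2.2
  have hI1 : IntegrableOn (fun s : ℝ => u s ^ 2 / s) (Ioi S) := by
    have h := (hinteg.mono_set (Ioi_subset_Ioi hSR)).const_mul (1 / 4)
    refine IntegrableOn.congr_fun h (fun s hs => ?_) measurableSet_Ioi
    have hs : S < s := hs
    rw [hform s (by linarith)]
    ring
  have hI2 : IntegrableOn (fun s : ℝ => u (s + Real.pi / 2) ^ 2 / (s + Real.pi / 2)) (Ioi S) := by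
    have h := hI1.mono_set (Ioi_subset_Ioi (show S ≤ S + Real.pi / 2 by linarith [Real.pi_pos]))
    have hmp := measurePreserving_add_right (volume : Measure ℝ) (Real.pi / 2)
    have := (hmp.integrableOn_comp_preimage
      (MeasurableEquiv.addRight (Real.pi / 2)).measurableEmbedding).2 h
    simpa [Function.comp_def] using this
  -- As `s ≥ 2` gives `s + π/2 ≤ 2s`, the two integrable functions together dominate `b²/(16 s)`,
  -- which is not integrable at infinity.
  have hI3 : IntegrableOn (fun s : ℝ => b ^ 2 / 16 * s⁻¹) (Ioi S) := by
    refine (hI1.add hI2).mono' (Measurable.aestronglyMeasurable (by fun_prop)) ?_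
    refine (ae_restrict_iff' measurableSet_Ioi).2 (Eventually.of_forall fun s hs => ?_)
    have hs : S < s := hs
    have hs0 : 0 < s := by linarith
    have h := (hS s hs.le).1
    have hpi := Real.pi_lt_four
    have hpi0 := Real.pi_pos
    rw [Real.norm_of_nonneg (by positivity), Pi.add_apply]
    have h4 : u (s + Real.pi / 2) ^ 2 / (2 * s) ≤
        u (s + Real.pi / 2) ^ 2 / (s + Real.pi / 2) := by
      gcongr
      linarith
    have h5 : u s ^ 2 / (2 * s) ≤ u s ^ 2 / s := by
      gcongr
      linarith
    refine le_trans ?_ (add_le_add h5 h4)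
    rw [← add_div, ← div_eq_mul_inv, div_le_div_iff₀ hs0 (by positivity)]
    nlinarith
  have hI4 := hI3.const_mul (16 / b ^ 2)
  refine not_integrableOn_Ioi_inv (a := S) (IntegrableOn.congr_fun hI4 (fun s _ => ?_)
    measurableSet_Ioi)
  have := hbpos.ne'
  field_simp

/-! ### Linear Bochner-Riesz kernels in any dimension. -/

/-- Any isometry onto the model space, followed by the reflection exchanging the image of `x` with
the axis vector of the same length. -/
lemma exists_linearIsometryEquiv_map_eq {V : Type*} [NormedAddCommGroup V]
    [InnerProductSpace ℝ V] [FiniteDimensional ℝ V] {m : ℕ} (hV : Module.finrank ℝ V = m + 1)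
    (x : V) :
    ∃ T : V ≃ₗᵢ[ℝ] WithLp 2 (ℝ × EuclideanSpace ℝ (Fin m)),
      T x = WithLp.toLp 2 (‖x‖, 0) := by
  have hdim : Module.finrank ℝ (WithLp 2 (ℝ × EuclideanSpace ℝ (Fin m))) = m + 1 := by
    rw [(WithLp.linearEquiv 2 ℝ (ℝ × EuclideanSpace ℝ (Fin m))).finrank_eq]
    simp [add_comm]
  let T₀ : V ≃ₗᵢ[ℝ] WithLp 2 (ℝ × EuclideanSpace ℝ (Fin m)) :=
    (stdOrthonormalBasis ℝ V).repr.trans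
      ((LinearIsometryEquiv.piLpCongrLeft 2 ℝ ℝ (finCongr (hV.trans hdim.symm))).trans
        (stdOrthonormalBasis ℝ _).repr.symm)
  refine ⟨T₀.trans (Submodule.reflection (ℝ ∙ (T₀ x - WithLp.toLp 2 (‖x‖, 0)))ᗮ), ?_⟩
  rw [LinearIsometryEquiv.trans_apply]
  refine Submodule.reflection_sub ?_
  rw [LinearIsometryEquiv.norm_map, WithLp.prod_norm_eq_of_L2]
  simp

section BallKernel

variable {V : Type*} [NormedAddCommGroup V] [InnerProductSpace ℝ V] [FiniteDimensional ℝ V]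
  [MeasurableSpace V] [BorelSpace V]

lemma integrable_ballSymbol_norm {δ : ℝ} (hδ : 0 ≤ δ) {a : ℝ} (ha : 0 < a) :
    Integrable (fun ξ : V => ballSymbol δ (a * ‖ξ‖ ^ 2)) := by
  have h : Integrable ((Metric.closedBall (0 : V) (√a)⁻¹).indicator fun _ => (1 : ℝ)) :=
    (integrable_indicator_iff Metric.isClosed_closedBall.measurableSet).2
      (integrableOn_const (isCompact_closedBall _ _).measure_lt_top.ne)
  refine h.mono' (Measurable.aestronglyMeasurable (by fun_prop)) (Eventually.of_forall fun ξ => ?_)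
  rw [Real.norm_of_nonneg (ballSymbol_nonneg _ _)]
  by_cases hξ : ξ ∈ Metric.closedBall (0 : V) (√a)⁻¹
  · rw [indicator_of_mem hξ]
    exact ballSymbol_le_one hδ (by positivity)
  · rw [indicator_of_notMem hξ, ballSymbol_of_lt]
    rw [mem_closedBall_zero_iff, not_le, inv_lt_iff_one_lt_mul₀' (by positivity)] at hξ
    calc (1 : ℝ) < (√a * ‖ξ‖) ^ 2 := by nlinarith
      _ = a * ‖ξ‖ ^ 2 := by rw [mul_pow, Real.sq_sqrt ha.le]

/-- The Bochner-Riesz kernel of the symbol `(1 - a|ξ|²)_+^δ`. -/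
def ballKernel (a δ : ℝ) (x : V) : ℂ :=
  ∫ ξ : V, Complex.exp (2 * Real.pi * Complex.I * (inner ℝ x ξ : ℝ)) *
    (ballSymbol δ (a * ‖ξ‖ ^ 2) : ℝ)

lemma ballKernel_eq_fourier (a δ : ℝ) (x : V) :
    ballKernel a δ x = 𝓕 (fun ξ : V => (ballSymbol δ (a * ‖ξ‖ ^ 2) : ℂ)) (-x) := by
  rw [Real.fourier_eq', ballKernel]
  refine integral_congr_ae (Eventually.of_forall fun ξ => ?_)
  simp only [smul_eq_mul]
  congr 2
  rw [inner_neg_right, real_inner_comm]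
  push_cast
  ring

/-- The symbol has bounded support, so all its moments are integrable. Smoothness is what later lets
the kernel itself enter a Schwartz test function. -/
lemma contDiff_ballKernel {a δ : ℝ} (ha : 0 < a) (hδ : 0 ≤ δ) :
    ContDiff ℝ (⊤ : ℕ∞) (ballKernel a δ : V → ℂ) := by
  have h : ContDiff ℝ (⊤ : ℕ∞) (𝓕 (fun ξ : V => (ballSymbol δ (a * ‖ξ‖ ^ 2) : ℂ))) := by
    refine Real.contDiff_fourier fun n _ => ?_
    refine ((integrable_ballSymbol_norm (V := V) hδ ha).const_mul ((√a)⁻¹ ^ n)).mono'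
      (Measurable.aestronglyMeasurable (by fun_prop)) (Eventually.of_forall fun ξ => ?_)
    rw [Complex.norm_real, norm_mul, norm_norm, norm_pow, norm_norm,
      Real.norm_of_nonneg (ballSymbol_nonneg _ _)]
    rcases le_or_gt (‖ξ‖) (√a)⁻¹ with h | h
    · have := ballSymbol_nonneg δ (a * ‖ξ‖ ^ 2)
      gcongr
    · rw [ballSymbol_of_lt]
      · simp
      rw [inv_lt_iff_one_lt_mul₀' (by positivity)] at h
      calc (1 : ℝ) < (√a * ‖ξ‖) ^ 2 := by nlinarith
        _ = a * ‖ξ‖ ^ 2 := by rw [mul_pow, Real.sq_sqrt ha.le]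
  have h2 := h.comp (contDiff_neg (𝕜 := ℝ) (F := V))
  convert h2 using 1
  ext x
  exact ballKernel_eq_fourier a δ x

lemma ballKernel_scale {a : ℝ} (ha : 0 < a) (δ : ℝ) (x : V) :
    ballKernel a δ x =
      (((√a)⁻¹ ^ Module.finrank ℝ V : ℝ) : ℂ) * ballKernel 1 δ ((√a)⁻¹ • x) := by
  have h := Measure.integral_comp_smul (volume : Measure V)
    (fun ξ => Complex.exp (2 * Real.pi * Complex.I * (inner ℝ ((√a)⁻¹ • x) ξ : ℝ)) *
    (ballSymbol δ (1 * ‖ξ‖ ^ 2) : ℝ)) (√a)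
  rw [abs_of_nonneg (by positivity), Complex.real_smul, ← inv_pow] at h
  rw [ballKernel, ballKernel, ← h]
  refine integral_congr_ae (Eventually.of_forall fun ξ => ?_)
  have : √a ≠ 0 := (Real.sqrt_pos.2 ha).ne'
  simp only
  rw [real_inner_smul_left, real_inner_smul_right, norm_smul, mul_pow, one_mul, ← mul_assoc,
    inv_mul_cancel₀ this, one_mul, Real.norm_of_nonneg (Real.sqrt_nonneg _), Real.sq_sqrt ha.le]

/-- Integrating `(1 - t² - |u|²)_+^δ` over a slice. -/
lemma integral_ballSymbol_slice (δ : ℝ) {t : ℝ} (ht : t ^ 2 ≠ 1) :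
    ∫ u : V, ballSymbol δ (t ^ 2 + ‖u‖ ^ 2) =
      ballSymbol (δ + Module.finrank ℝ V / 2) (t ^ 2) * ∫ u : V, ballSymbol δ (1 * ‖u‖ ^ 2) := by
  rcases lt_or_gt_of_ne ht with h | h
  · set r := √(1 - t ^ 2) with hr
    have hpos : 0 < 1 - t ^ 2 := by linarith
    have hr0 : 0 < r := Real.sqrt_pos.2 hpos
    have hr2 : r ^ 2 = 1 - t ^ 2 := Real.sq_sqrt hpos.le
    have hs := Measure.integral_comp_smul (volume : Measure V)
      (fun u => ballSymbol δ (t ^ 2 + ‖u‖ ^ 2)) r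
    rw [abs_of_nonneg (by positivity), smul_eq_mul] at hs
    have h1 : ∀ u : V, ballSymbol δ (t ^ 2 + ‖r • u‖ ^ 2) =
        (1 - t ^ 2) ^ δ * ballSymbol δ (1 * ‖u‖ ^ 2) := by
      intro u
      rw [norm_smul, mul_pow, Real.norm_of_nonneg hr0.le, hr2, one_mul]
      rcases le_or_gt (‖u‖ ^ 2) 1 with h2 | h2
      · rw [ballSymbol_of_le h2, ballSymbol_of_le (by nlinarith),
          ← Real.mul_rpow hpos.le (by linarith)]
        congr 1
        ring
      · rw [ballSymbol_of_lt h2, ballSymbol_of_lt (by nlinarith), mul_zero]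
    simp_rw [h1] at hs
    rw [integral_const_mul] at hs
    have h3 : (1 - t ^ 2) ^ ((Module.finrank ℝ V : ℝ) / 2) = r ^ Module.finrank ℝ V := by
      rw [hr, Real.sqrt_eq_rpow, ← Real.rpow_mul_natCast hpos.le]
      congr 1
      ring
    rw [ballSymbol_of_le h.le, Real.rpow_add hpos, h3, mul_right_comm, hs, mul_comm, ← mul_assoc,
      mul_inv_cancel₀ (by positivity), one_mul]
  · rw [ballSymbol_of_lt h, zero_mul]
    refine integral_eq_zero_of_ae (Eventually.of_forall fun u => ballSymbol_of_lt ?_)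
    nlinarith [sq_nonneg ‖u‖]

lemma integral_ballSymbol_norm_pos {δ : ℝ} (hδ : 0 ≤ δ) :
    0 < ∫ u : V, ballSymbol δ (1 * ‖u‖ ^ 2) := by
  rw [integral_pos_iff_support_of_nonneg (fun u => ballSymbol_nonneg _ _)
    (integrable_ballSymbol_norm hδ one_pos)]
  refine lt_of_lt_of_le (Metric.measure_ball_pos volume (0 : V) one_pos) (measure_mono ?_)
  intro u hu
  rw [mem_ball_zero_iff] at hu
  have : 0 < 1 - 1 * ‖u‖ ^ 2 := by nlinarith [norm_nonneg u]
  rw [Function.mem_support, ballSymbol_of_le (by linarith)]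
  exact (Real.rpow_pos_of_pos this _).ne'

/-- The Bochner-Riesz kernel as a one-dimensional oscillatory integral. -/
lemma ballKernel_eq_osc {m : ℕ} (hV : Module.finrank ℝ V = m + 1) {δ : ℝ} (hδ : 0 ≤ δ) (x : V) :
    ballKernel 1 δ x =
      ((∫ u : EuclideanSpace ℝ (Fin m), ballSymbol δ (1 * ‖u‖ ^ 2) : ℝ) : ℂ) *
        osc (δ + m / 2) (2 * Real.pi * ‖x‖) := by
  obtain ⟨T, hT⟩ := exists_linearIsometryEquiv_map_eq hV x
  set W := EuclideanSpace ℝ (Fin m)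
  have h1 : ballKernel 1 δ x = ballKernel 1 δ (T x) := by
    rw [ballKernel, ballKernel, ← T.measurePreserving.integral_comp
      T.toMeasurableEquiv.measurableEmbedding]
    simp only [LinearIsometryEquiv.inner_map_map, LinearIsometryEquiv.norm_map]
  have hmp := WithLp.volume_preserving_toLp ℝ W
  have hemb : MeasurableEmbedding (@WithLp.toLp 2 (ℝ × W)) :=
    (MeasurableEquiv.toLp 2 (ℝ × W)).measurableEmbedding
  have h2 : ballKernel 1 δ (T x) = ∫ q : ℝ × W,
      Complex.exp (Complex.I * (2 * Real.pi * ‖x‖ : ℝ) * q.1) *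
        (ballSymbol δ (q.1 ^ 2 + ‖q.2‖ ^ 2) : ℝ) := by
    rw [ballKernel, ← hmp.integral_comp hemb, hT]
    refine integral_congr_ae (Eventually.of_forall fun q => ?_)
    simp only [WithLp.prod_inner_apply, WithLp.prod_norm_sq_eq_of_L2, inner_zero_left,
      add_zero, one_mul, RCLike.inner_apply, conj_trivial, Real.norm_eq_abs, sq_abs]
    congr 2
    push_cast
    ring
  have hinteg : Integrable (fun q : ℝ × W =>
      Complex.exp (Complex.I * (2 * Real.pi * ‖x‖ : ℝ) * q.1) *
        (ballSymbol δ (q.1 ^ 2 + ‖q.2‖ ^ 2) : ℝ)) (volume.prod volume) := by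
    have hb := (hmp.integrable_comp_emb hemb).2
      (integrable_ballSymbol_norm (V := WithLp 2 (ℝ × W)) hδ one_pos)
    refine Integrable.mono' hb (Measurable.aestronglyMeasurable (by fun_prop))
      (Eventually.of_forall fun q => ?_)
    simp only [Function.comp, WithLp.prod_norm_sq_eq_of_L2, one_mul, Real.norm_eq_abs, sq_abs]
    rw [norm_mul, Complex.norm_real, Real.norm_of_nonneg (ballSymbol_nonneg _ _), mul_assoc,
      ← Complex.ofReal_mul, mul_comm Complex.I, Complex.norm_exp_ofReal_mul_I, one_mul]
    exact le_rfl
  rw [h1, h2, Measure.volume_eq_prod, integral_prod _ hinteg, osc, ← integral_const_mul]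
  -- The slice formula is available off `t = ±1` only, which is a null set.
  have hne : ∀ᵐ t : ℝ, t ^ 2 ≠ 1 := by
    have : ({1, -1} : Set ℝ).Countable := (Set.toFinite _).countable
    filter_upwards [this.ae_notMem volume] with t ht h
    exact ht (by simpa using h)
  refine integral_congr_ae ?_
  filter_upwards [hne] with t ht
  rw [integral_const_mul, integral_complex_ofReal, integral_ballSymbol_slice δ ht]
  rw [show Module.finrank ℝ W = m from finrank_euclideanSpace_fin]
  push_cast
  ring

/-- The size of the Bochner-Riesz kernel. -/
lemma exists_norm_ballKernel_le [Nontrivial V] {δ : ℝ} (hδ : 0 ≤ δ) :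
    ∃ C : ℝ, 0 < C ∧ ∀ x : V, ‖ballKernel 1 δ x‖ ≤
      C * (1 + ‖x‖) ^ (-(δ + (Module.finrank ℝ V + 1) / 2)) := by
  obtain ⟨m, hm⟩ := Nat.exists_eq_succ_of_ne_zero (Module.finrank_pos (R := ℝ) (M := V)).ne'
  obtain ⟨C, hC, h⟩ := exists_norm_osc_le (μ := δ + m / 2) (by positivity)
  set c := ∫ u : EuclideanSpace ℝ (Fin m), ballSymbol δ (1 * ‖u‖ ^ 2)
  have hc : 0 < c := integral_ballSymbol_norm_pos hδ
  refine ⟨c * C, by positivity, fun x => ?_⟩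
  rw [ballKernel_eq_osc hm hδ x, norm_mul, Complex.norm_real, Real.norm_of_nonneg hc.le,
    mul_assoc c]
  refine mul_le_mul_of_nonneg_left ((h _ (by positivity)).trans ?_) hc.le
  refine mul_le_mul_of_nonneg_left ?_ hC.le
  have e : -(δ + m / 2 + 1) = -(δ + ((Module.finrank ℝ V : ℝ) + 1) / 2) := by
    rw [hm]; push_cast; ring
  rw [e]
  refine Real.rpow_le_rpow_of_nonpos (by positivity) ?_ (by
    rw [neg_nonpos]; positivity)
  nlinarith [norm_nonneg x, Real.pi_gt_three]

/-- A Bochner-Riesz kernel on `W`, pulled back to `V` by a map which scales the norm, is not square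
integrable against the critical weight. -/
lemma not_integrable_ballKernel_sq {W : Type*} [NormedAddCommGroup W] [InnerProductSpace ℝ W]
    [FiniteDimensional ℝ W] [MeasurableSpace W] [BorelSpace W] [Nontrivial V] [Nontrivial W]
    {δ : ℝ} (hδ : 0 ≤ δ) {r : ℝ} (hr : 0 < r) {L : V → W} (hL : ∀ x, ‖L x‖ = r * ‖x‖) :
    ¬ Integrable (fun x : V => ‖ballKernel 1 δ (L x)‖ ^ 2 *
      (1 + ‖x‖ ^ 2) ^ (δ + (Module.finrank ℝ W + 1) / 2 - Module.finrank ℝ V / 2 : ℝ)) := by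
  obtain ⟨m, hm⟩ := Nat.exists_eq_succ_of_ne_zero (Module.finrank_pos (R := ℝ) (M := W)).ne'
  obtain ⟨d, hd⟩ := Nat.exists_eq_succ_of_ne_zero (Module.finrank_pos (R := ℝ) (M := V)).ne'
  set c := ∫ u : EuclideanSpace ℝ (Fin m), ballSymbol δ (1 * ‖u‖ ^ 2)
  have hc : 0 < c := integral_ballSymbol_norm_pos hδ
  set κ := 2 * Real.pi * r with hκ
  have hκ0 : 0 < κ := by positivity
  set μ := δ + (m : ℝ) / 2 with hμ
  have hμ0 : 0 ≤ μ := by positivity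
  set ν : ℝ := δ + (Module.finrank ℝ W + 1) / 2 - Module.finrank ℝ V / 2 with hν
  -- In polar coordinates the Jacobian `s^d`, where `d = dim V - 1`, times the weight `s^{2ν}` is
  -- exactly the divergent power `s^{2μ+1}`.
  have hνe : 2 * ν + d = 2 * μ + 1 := by
    rw [hν, hm, hd, hμ]; push_cast; ring
  intro hinteg
  have h1 : Integrable (fun x : V => (fun s : ℝ => (c * ‖osc μ (κ * s)‖) ^ 2 * (1 + s ^ 2) ^ ν)
      ‖x‖) := by
    refine hinteg.congr (Eventually.of_forall fun x => ?_)
    simp only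
    rw [ballKernel_eq_osc hm hδ, norm_mul, Complex.norm_real, Real.norm_of_nonneg hc.le, hL,
      ← mul_assoc]
  replace h1 := (integrable_fun_norm_addHaar (volume : Measure V)
    (f := fun s : ℝ => (c * ‖osc μ (κ * s)‖) ^ 2 * (1 + s ^ 2) ^ ν)).1 h1
  rw [hd, Nat.succ_sub_one] at h1
  have h2 : IntegrableOn (fun s : ℝ => s ^ (2 * μ + 1) * ‖osc μ (κ * s)‖ ^ 2) (Ioi 1) := by
    have hosc : Measurable (osc μ) := by
      unfold osc
      refine StronglyMeasurable.measurable ?_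
      exact StronglyMeasurable.integral_prod_right (f := fun s t : ℝ =>
        Complex.exp (Complex.I * s * t) * (ballSymbol μ (t ^ 2) : ℝ))
        (Measurable.stronglyMeasurable (by fun_prop))
    have h3 := ((h1.mono_set (Ioi_subset_Ioi zero_le_one)).const_mul (2 ^ |ν| / c ^ 2))
    refine h3.mono' (Measurable.aestronglyMeasurable (by fun_prop)) ?_
    refine (ae_restrict_iff' measurableSet_Ioi).2 (Eventually.of_forall fun s hs => ?_)
    have hs : 1 < s := hs
    have hs0 : 0 < s := by linarith
    rw [Real.norm_of_nonneg (by positivity), smul_eq_mul]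
    -- For `ν ≥ 0` this is monotonicity; for `ν ≤ 0` it uses `1 + s² ≤ 2 s²`, valid as `s > 1`.
    have h4 : (s ^ 2) ^ ν ≤ 2 ^ |ν| * (1 + s ^ 2) ^ ν := by
      rcases le_total 0 ν with hv | hv
      · rw [abs_of_nonneg hv]
        calc (s ^ 2) ^ ν ≤ 1 * (1 + s ^ 2) ^ ν := by
              rw [one_mul]; gcongr; linarith
          _ ≤ _ := by
              gcongr
              exact Real.one_le_rpow (by norm_num) hv
      · rw [abs_of_nonpos hv, Real.rpow_neg (by norm_num), ← Real.inv_rpow (by norm_num),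
          ← Real.mul_rpow (by norm_num) (by positivity)]
        exact Real.rpow_le_rpow_of_nonpos (by positivity) (by nlinarith) hv
    have h5 : s ^ (2 * μ + 1) = s ^ d * (s ^ 2) ^ ν := by
      rw [← hνe, Real.rpow_add hs0, Real.rpow_natCast, mul_comm,
        Real.rpow_mul hs0.le, Real.rpow_ofNat]
    rw [h5]
    calc s ^ d * (s ^ 2) ^ ν * ‖osc μ (κ * s)‖ ^ 2
        ≤ s ^ d * (2 ^ |ν| * (1 + s ^ 2) ^ ν) * ‖osc μ (κ * s)‖ ^ 2 := by gcongr
      _ = _ := by field_simp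
  refine not_integrableOn_osc_sq hμ0 (κ * 1) ?_
  have h6 : IntegrableOn (fun s : ℝ => (κ * s) ^ (2 * μ + 1) * ‖osc μ (κ * s)‖ ^ 2) (Ioi 1) := by
    refine IntegrableOn.congr_fun (h2.const_mul (κ ^ (2 * μ + 1))) (fun s hs => ?_)
      measurableSet_Ioi
    have hs : 1 < s := hs
    rw [Real.mul_rpow hκ0.le (by linarith), mul_assoc (κ ^ _)]
  exact (integrableOn_Ioi_comp_mul_left_iff
    (fun s : ℝ => s ^ (2 * μ + 1) * ‖osc μ s‖ ^ 2) 1 hκ0).1 h6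

end BallKernel

/-! ### The bilinear kernel. -/

variable {n : ℕ}

lemma setIntegral_unitBall_eq (δ : ℝ) (G H : Eucl n × Eucl n → ℂ) :
    ∫ ζ in unitBall n, G ζ * ((1 - ‖ζ.1‖ ^ 2 - ‖ζ.2‖ ^ 2) ^ δ : ℝ) * H ζ =
      ∫ ζ : Eucl n × Eucl n, G ζ * (ballSymbol δ (‖ζ.1‖ ^ 2 + ‖ζ.2‖ ^ 2) : ℝ) * H ζ := by
  have hm : MeasurableSet (unitBall n) :=
    measurableSet_le (f := fun ζ : Eucl n × Eucl n => ‖ζ.1‖ ^ 2 + ‖ζ.2‖ ^ 2) (by fun_prop)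
      measurable_const
  rw [← integral_indicator hm]
  refine integral_congr_ae (Eventually.of_forall fun ζ => ?_)
  by_cases hζ : ζ ∈ unitBall n
  · have h : ‖ζ.1‖ ^ 2 + ‖ζ.2‖ ^ 2 ≤ 1 := hζ
    rw [indicator_of_mem hζ]
    simp only
    rw [ballSymbol_of_le h, sub_sub]
  · have h : 1 < ‖ζ.1‖ ^ 2 + ‖ζ.2‖ ^ 2 := not_le.1 hζ
    rw [indicator_of_notMem hζ]
    simp only
    rw [ballSymbol_of_lt h, Complex.ofReal_zero, mul_zero, zero_mul]

lemma bochnerRiesz_eq (δ : ℝ) (f g : Eucl n → ℂ) (x : Eucl n) :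
    bochnerRiesz δ f g x = ∫ ζ : Eucl n × Eucl n,
      Complex.exp (2 * Real.pi * Complex.I * (inner ℝ x (ζ.1 + ζ.2) : ℝ)) *
        (ballSymbol δ (‖ζ.1‖ ^ 2 + ‖ζ.2‖ ^ 2) : ℝ) * (𝓕 f ζ.1 * 𝓕 g ζ.2) := by
  rw [bochnerRiesz, ← setIntegral_unitBall_eq]
  simp only [mul_assoc]

lemma kernel_eq_integral (δ : ℝ) (w : Eucl n × Eucl n) :
    kernel δ w = ∫ ζ : Eucl n × Eucl n,
      Complex.exp (2 * Real.pi * Complex.I * (inner ℝ w.1 ζ.1 + inner ℝ w.2 ζ.2 : ℝ)) *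
        (ballSymbol δ (‖ζ.1‖ ^ 2 + ‖ζ.2‖ ^ 2) : ℝ) := by
  have := setIntegral_unitBall_eq δ (fun ζ : Eucl n × Eucl n =>
    Complex.exp (2 * Real.pi * Complex.I * (inner ℝ w.1 ζ.1 + inner ℝ w.2 ζ.2 : ℝ))) (fun _ => 1)
  simp only [mul_one] at this
  rw [kernel, this]

/-- The product type carries the sup norm; passing to `WithLp 2` restores the Euclidean norm of
`ℝ²ⁿ`, where the symbol is radial and the linear theory applies. -/
lemma kernel_eq_ballKernel (δ : ℝ) (w : Eucl n × Eucl n) :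
    kernel δ w = ballKernel 1 δ (WithLp.toLp 2 w) := by
  have hmp := WithLp.volume_preserving_toLp (Eucl n) (Eucl n)
  have hemb : MeasurableEmbedding (@WithLp.toLp 2 (Eucl n × Eucl n)) :=
    (MeasurableEquiv.toLp 2 (Eucl n × Eucl n)).measurableEmbedding
  rw [kernel_eq_integral, ballKernel, ← hmp.integral_comp hemb]
  simp only [WithLp.prod_inner_apply, WithLp.prod_norm_sq_eq_of_L2, one_mul]
  rfl

lemma integrable_ballSymbol_prod {δ : ℝ} (hδ : 0 ≤ δ) :
    Integrable (fun ζ : Eucl n × Eucl n => ballSymbol δ (‖ζ.1‖ ^ 2 + ‖ζ.2‖ ^ 2)) := by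
  have hmp := WithLp.volume_preserving_toLp (Eucl n) (Eucl n)
  have hemb : MeasurableEmbedding (@WithLp.toLp 2 (Eucl n × Eucl n)) :=
    (MeasurableEquiv.toLp 2 (Eucl n × Eucl n)).measurableEmbedding
  have hb := (hmp.integrable_comp_emb hemb).2
    (integrable_ballSymbol_norm (V := WithLp 2 (Eucl n × Eucl n)) hδ one_pos)
  simp only [Function.comp_def, WithLp.prod_norm_sq_eq_of_L2, one_mul] at hb
  exact hb

lemma continuous_kernel {δ : ℝ} (hδ : 0 ≤ δ) :
    Continuous (kernel δ : Eucl n × Eucl n → ℂ) := by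
  have h := (contDiff_ballKernel (V := WithLp 2 (Eucl n × Eucl n)) one_pos hδ).continuous.comp
    (WithLp.prod_continuous_toLp 2 (Eucl n) (Eucl n))
  exact h.congr fun w => (kernel_eq_ballKernel δ w).symm

lemma norm_exp_two_pi_I_mul (t : ℝ) :
    ‖Complex.exp (2 * Real.pi * Complex.I * (t : ℂ))‖ = 1 := by
  rw [show (2 * Real.pi * Complex.I * t : ℂ) = ((2 * Real.pi * t : ℝ) : ℂ) * Complex.I by
    push_cast; ring]
  exact Complex.norm_exp_ofReal_mul_I _

/-- On integrable functions the kernel representation agrees with the Fourier integral. -/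
lemma kernelOp_eq_bochnerRiesz {δ : ℝ} (hδ : 0 ≤ δ) {f g : Eucl n → ℂ} (hf : Integrable f)
    (hg : Integrable g) (x : Eucl n) : kernelOp δ f g x = bochnerRiesz δ f g x := by
  set F : Eucl n × Eucl n → Eucl n × Eucl n → ℂ := fun w ζ =>
    Complex.exp (2 * Real.pi * Complex.I *
      (inner ℝ (x - w.1) ζ.1 + inner ℝ (x - w.2) ζ.2 : ℝ)) *
        (ballSymbol δ (‖ζ.1‖ ^ 2 + ‖ζ.2‖ ^ 2) : ℝ) * (f w.1 * g w.2) with hF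
  have h1 : kernelOp δ f g x = ∫ w, ∫ ζ, F w ζ := by
    refine integral_congr_ae (Eventually.of_forall fun w => ?_)
    simp only [kernelIntegrand, kernel_eq_integral, hF]
    rw [integral_mul_const, mul_assoc]
  have hfg : Integrable (fun w : Eucl n × Eucl n => f w.1 * g w.2) := hf.mul_prod hg
  have hinteg : Integrable (Function.uncurry F) (volume.prod volume) := by
    have h2 := hfg.norm.mul_prod (integrable_ballSymbol_prod (n := n) hδ)
    refine h2.mono' ?_ (Eventually.of_forall fun q => ?_)
    · refine AEStronglyMeasurable.mul (Measurable.aestronglyMeasurable (by fun_prop)) ?_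
      exact hfg.1.comp_quasiMeasurePreserving Measure.quasiMeasurePreserving_fst
    · simp only [Function.uncurry, hF]
      rw [norm_mul, norm_mul, norm_exp_two_pi_I_mul, Complex.norm_real, one_mul,
        Real.norm_of_nonneg (ballSymbol_nonneg _ _), mul_comm]
  rw [h1, integral_integral_swap hinteg, bochnerRiesz_eq]
  refine integral_congr_ae (Eventually.of_forall fun ζ => ?_)
  simp only [Real.fourier_eq', hF]
  rw [← integral_prod_mul, ← Measure.volume_eq_prod, ← integral_const_mul]
  refine integral_congr_ae (Eventually.of_forall fun w => ?_)
  simp only [smul_eq_mul]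
  have he : Complex.exp (2 * Real.pi * Complex.I *
      (inner ℝ (x - w.1) ζ.1 + inner ℝ (x - w.2) ζ.2 : ℝ)) =
      Complex.exp (2 * Real.pi * Complex.I * (inner ℝ x (ζ.1 + ζ.2) : ℝ)) *
      Complex.exp (((-2 * Real.pi * inner ℝ w.1 ζ.1 : ℝ) : ℂ) * Complex.I) *
      Complex.exp (((-2 * Real.pi * inner ℝ w.2 ζ.2 : ℝ) : ℂ) * Complex.I) := by
    rw [← Complex.exp_add, ← Complex.exp_add, inner_sub_left, inner_sub_left, inner_add_right]
    congr 1
    push_cast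
    ring
  rw [he]
  ring

/-! ### Boundedness for `δ > n - 1/2`. -/

/-- Young's inequality `‖Φ * F‖_p ≤ ‖Φ‖₁ ‖F‖_p` for non-negative functions. -/
lemma eLpNorm_lintegral_sub_mul_le {Φ F : Eucl n → ℝ≥0∞} (hΦ : Measurable Φ)
    (hF : AEMeasurable F) {p : ℝ≥0∞} (hp : 1 ≤ p) :
    eLpNorm (fun x => ∫⁻ y, Φ (x - y) * F y) p volume ≤ (∫⁻ y, Φ y) * eLpNorm F p volume := by
  have hΦx : ∀ x : Eucl n, ∫⁻ y, Φ (x - y) = ∫⁻ y, Φ y := fun x =>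
    lintegral_sub_left_eq_self (fun y => Φ y) x
  rcases eq_or_ne p ∞ with rfl | hp'
  · rw [eLpNorm_exponent_top, eLpNorm_exponent_top]
    refine essSup_le_of_ae_le _ (Eventually.of_forall fun x => ?_)
    simp only [enorm_eq_self]
    calc ∫⁻ y, Φ (x - y) * F y ≤ ∫⁻ y, Φ (x - y) * eLpNormEssSup F volume := by
          refine lintegral_mono_ae ?_
          filter_upwards [enorm_ae_le_eLpNormEssSup F volume] with y hy
          rw [enorm_eq_self] at hy
          gcongr
      _ = _ := by rw [lintegral_mul_const _ (by fun_prop), hΦx]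
  have hp0 : p ≠ 0 := (zero_lt_one.trans_le hp).ne'
  set r := p.toReal with hr
  have hr1 : 1 ≤ r := by
    rw [hr, ← ENNReal.toReal_one]
    exact ENNReal.toReal_mono hp' hp
  have hr0 : 0 < r := by linarith
  set I := ∫⁻ y, Φ y with hI
  have hpt : ∀ x : Eucl n, (∫⁻ y, Φ (x - y) * F y) ^ r ≤
      I ^ (r - 1) * ∫⁻ y, Φ (x - y) * F y ^ r := by
    intro x
    -- Jensen's inequality for the measure `Φ(x - y) dy` of total mass `I`, in the form of the
    -- comparison of its `L¹` and `L^p` norms.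
    set ν := (volume : Measure (Eucl n)).withDensity fun y => Φ (x - y) with hν
    have hac : ν ≪ volume := withDensity_absolutelyContinuous _ _
    have hle := eLpNorm_le_eLpNorm_mul_rpow_measure_univ (μ := ν) hp
      (hF.mono_ac hac).aestronglyMeasurable
    have hΦm : Measurable fun y => Φ (x - y) := by fun_prop
    have huniv : ν univ = I := by
      rw [hν, withDensity_apply _ MeasurableSet.univ, Measure.restrict_univ, hΦx]
    rw [eLpNorm_one_eq_lintegral_enorm, eLpNorm_eq_lintegral_rpow_enorm_toReal hp0 hp', huniv,
      hν, lintegral_withDensity_eq_lintegral_mul₀ hΦm.aemeasurable hF.enorm,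
      lintegral_withDensity_eq_lintegral_mul₀ hΦm.aemeasurable (hF.enorm.pow_const _)] at hle
    simp only [Pi.mul_apply, enorm_eq_self, ENNReal.toReal_one, ← hr] at hle
    calc _ ≤ _ := ENNReal.rpow_le_rpow hle hr0.le
      _ = _ := by
        rw [ENNReal.mul_rpow_of_nonneg _ _ hr0.le, ← ENNReal.rpow_mul, ← ENNReal.rpow_mul,
          one_div_mul_cancel hr0.ne', ENNReal.rpow_one, mul_comm]
        congr 2
        field_simp
  rw [eLpNorm_eq_lintegral_rpow_enorm_toReal hp0 hp',
    eLpNorm_eq_lintegral_rpow_enorm_toReal hp0 hp', ← hr]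
  simp only [enorm_eq_self]
  have hswap : ∫⁻ x, ∫⁻ y, Φ (x - y) * F y ^ r = I * ∫⁻ y, F y ^ r := by
    rw [lintegral_lintegral_swap]
    · have : ∀ y : Eucl n, ∫⁻ x, Φ (x - y) * F y ^ r = I * F y ^ r := by
        intro y
        rw [lintegral_mul_const _ (by fun_prop), lintegral_sub_right_eq_self Φ y]
      simp_rw [this]
      rw [lintegral_const_mul'' _ (hF.pow_const _)]
    · exact (by fun_prop : Measurable fun q : Eucl n × Eucl n => Φ (q.1 - q.2)).aemeasurable.mul
        ((hF.pow_const r).comp_quasiMeasurePreserving Measure.quasiMeasurePreserving_snd)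
  calc (∫⁻ x, (∫⁻ y, Φ (x - y) * F y) ^ r) ^ (1 / r)
      ≤ (∫⁻ x, I ^ (r - 1) * ∫⁻ y, Φ (x - y) * F y ^ r) ^ (1 / r) := by
        gcongr with x
        exact hpt x
    _ = (I ^ (r - 1) * (I * ∫⁻ y, F y ^ r)) ^ (1 / r) := by
        rw [lintegral_const_mul'', hswap]
        refine AEMeasurable.lintegral_prod_right' (f := fun q : Eucl n × Eucl n =>
          Φ (q.1 - q.2) * F q.2 ^ r) ?_
        exact (by fun_prop : Measurable fun q : Eucl n × Eucl n => Φ (q.1 - q.2)).aemeasurable.mul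
          ((hF.pow_const r).comp_quasiMeasurePreserving Measure.quasiMeasurePreserving_snd)
    _ = I * (∫⁻ y, F y ^ r) ^ (1 / r) := by
        have h1 : I ^ (r - 1) * I = I ^ r := by
          nth_rw 2 [← ENNReal.rpow_one I]
          rw [← ENNReal.rpow_add_of_nonneg _ _ (by linarith) zero_le_one, sub_add_cancel]
        rw [← mul_assoc, h1, ENNReal.mul_rpow_of_nonneg _ _ (by positivity), ← ENNReal.rpow_mul,
          mul_one_div_cancel hr0.ne', ENNReal.rpow_one]

lemma finrank_withLp_prod (n : ℕ) : Module.finrank ℝ (WithLp 2 (Eucl n × Eucl n)) = 2 * n := by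
  rw [(WithLp.linearEquiv 2 ℝ (Eucl n × Eucl n)).finrank_eq]
  simp [two_mul]

/-- The product bound for the kernel. -/
lemma exists_norm_kernel_le (hn : 1 ≤ n) {δ : ℝ} (hδ : 0 ≤ δ) :
    ∃ C : ℝ, 0 < C ∧ ∀ w : Eucl n × Eucl n, ‖kernel δ w‖ ≤
      C * ((1 + ‖w.1‖) ^ (-((δ + (2 * n + 1) / 2) / 2)) *
        (1 + ‖w.2‖) ^ (-((δ + (2 * n + 1) / 2) / 2))) := by
  have : Nonempty (Fin n) := ⟨⟨0, hn⟩⟩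
  have : Nontrivial (WithLp 2 (Eucl n × Eucl n)) := (WithLp.equiv 2 _).nontrivial
  obtain ⟨C, hC, h⟩ := exists_norm_ballKernel_le (V := WithLp 2 (Eucl n × Eucl n)) hδ
  refine ⟨C, hC, fun w => ?_⟩
  rw [kernel_eq_ballKernel]
  refine (h _).trans (mul_le_mul_of_nonneg_left ?_ hC.le)
  set N := ‖WithLp.toLp 2 w‖ with hN
  have hsq : N ^ 2 = ‖w.1‖ ^ 2 + ‖w.2‖ ^ 2 := WithLp.prod_norm_sq_eq_of_L2 _
  have h0 : 0 ≤ N := norm_nonneg _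
  have h1 : ‖w.1‖ ≤ N := abs_le_of_sq_le_sq' (by nlinarith [sq_nonneg ‖w.2‖]) h0 |>.2
  have h2 : ‖w.2‖ ≤ N := abs_le_of_sq_le_sq' (by nlinarith [sq_nonneg ‖w.1‖]) h0 |>.2
  rw [← Real.mul_rpow (by positivity) (by positivity), finrank_withLp_prod]
  set q := (δ + (2 * (n : ℝ) + 1) / 2) / 2 with hq
  have hq0 : 0 ≤ q := by positivity
  -- The full decay exponent is `2q`, and `(1 + N)² ≥ (1 + ‖w.1‖)(1 + ‖w.2‖)` gives each variable
  -- the exponent `q`.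
  have : (1 + N) ^ (-(δ + (((2 * n : ℕ) : ℝ) + 1) / 2)) = ((1 + N) ^ 2) ^ (-q) := by
    rw [← Real.rpow_natCast, ← Real.rpow_mul (by positivity)]
    congr 1
    rw [hq]
    push_cast
    ring
  rw [this]
  refine Real.rpow_le_rpow_of_nonpos (by positivity) ?_ (by linarith)
  nlinarith [norm_nonneg w.1, norm_nonneg w.2, mul_le_mul h1 h2 (norm_nonneg _) h0]

/-- The absolutely convergent kernel representation for `δ > n - 1/2`. -/
lemma exists_kernelOp_bound (hn : 1 ≤ n) {δ : ℝ} (hδ : (n : ℝ) - 1 / 2 < δ) {p₁ p₂ p : ℝ≥0∞}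
    (h₁ : 1 ≤ p₁) (h₂ : 1 ≤ p₂) (hp : p⁻¹ = p₁⁻¹ + p₂⁻¹) :
    ∃ C : ℝ≥0, ∀ f g : Eucl n → ℂ, MemLp f p₁ volume → MemLp g p₂ volume →
      (∀ᵐ x, Integrable (kernelIntegrand δ f g x) volume) ∧
      MemLp (kernelOp δ f g) p volume ∧
      eLpNorm (kernelOp δ f g) p volume ≤ C * eLpNorm f p₁ volume * eLpNorm g p₂ volume := by
  have hn' : (1 : ℝ) ≤ n := by exact_mod_cast hn
  have hδ0 : 0 ≤ δ := by linarith
  obtain ⟨C, hC, hK⟩ := exists_norm_kernel_le hn hδ0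
  set q := (δ + (2 * (n : ℝ) + 1) / 2) / 2 with hq
  -- Here `q = (δ + n + 1/2)/2`, so `q > n` is the hypothesis `δ > n - 1/2`, and it makes `φ`
  -- integrable on `ℝⁿ`.
  have hqn : (n : ℝ) < q := by linarith
  set φ : Eucl n → ℝ := fun x => (1 + ‖x‖) ^ (-q) with hφ
  have hφi : Integrable φ := integrable_one_add_norm (by simpa using hqn)
  set Φ : Eucl n → ℝ≥0∞ := fun x => ‖φ x‖ₑ with hΦ
  have hΦm : Measurable Φ := by fun_prop
  set I := ∫⁻ x, Φ x with hI
  have hI' : I ≠ ∞ := hφi.2.ne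
  refine ⟨C.toNNReal * (I.toNNReal * I.toNNReal), fun f g hf hg => ?_⟩
  have key : ∀ (h : Eucl n → ℂ) (r : ℝ≥0∞), 1 ≤ r → MemLp h r volume →
      eLpNorm (fun x => ∫⁻ y, Φ (x - y) * ‖h y‖ₑ) r volume ≤ I * eLpNorm h r volume := by
    intro h r hr hh
    have := eLpNorm_lintegral_sub_mul_le hΦm hh.1.enorm hr
    rwa [eLpNorm_enorm] at this
  have hmeas : ∀ (h : Eucl n → ℂ) (r : ℝ≥0∞), MemLp h r volume →
      AEMeasurable (fun x => ∫⁻ y, Φ (x - y) * ‖h y‖ₑ) volume := by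
    intro h r hh
    refine AEMeasurable.lintegral_prod_right' (f := fun q : Eucl n × Eucl n =>
      Φ (q.1 - q.2) * ‖h q.2‖ₑ) ?_
    exact (by fun_prop : Measurable fun q : Eucl n × Eucl n => Φ (q.1 - q.2)).aemeasurable.mul
      (hh.1.enorm.comp_quasiMeasurePreserving Measure.quasiMeasurePreserving_snd)
  have hfin : ∀ (h : Eucl n → ℂ) (r : ℝ≥0∞), 1 ≤ r → MemLp h r volume →
      ∀ᵐ x, ∫⁻ y, Φ (x - y) * ‖h y‖ₑ < ∞ := by
    intro h r hr hh
    have hlt : eLpNorm (fun x => ∫⁻ y, Φ (x - y) * ‖h y‖ₑ) r volume < ∞ :=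
      (key h r hr hh).trans_lt (ENNReal.mul_lt_top hI'.lt_top hh.2)
    have hr0 : r ≠ 0 := (zero_lt_one.trans_le hr).ne'
    rcases eq_or_ne r ∞ with rfl | hr'
    · rw [eLpNorm_exponent_top] at hlt
      filter_upwards [enorm_ae_le_eLpNormEssSup (fun x => ∫⁻ y, Φ (x - y) * ‖h y‖ₑ) volume]
        with x hx
      rw [enorm_eq_self] at hx
      exact hx.trans_lt hlt
    · have h3 := lintegral_rpow_enorm_lt_top_of_eLpNorm_lt_top hr0 hr' hlt
      simp only [enorm_eq_self] at h3
      filter_upwards [ae_lt_top' ((hmeas h r hh).pow_const _) h3.ne] with x hx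
      exact (ENNReal.rpow_lt_top_iff_of_pos (ENNReal.toReal_pos hr0 hr')).1 hx
  set A : Eucl n → ℝ≥0∞ := fun x => ∫⁻ y, Φ (x - y) * ‖f y‖ₑ with hA
  set B : Eucl n → ℝ≥0∞ := fun x => ∫⁻ y, Φ (x - y) * ‖g y‖ₑ with hB
  have hfgm : AEStronglyMeasurable (fun w : Eucl n × Eucl n => f w.1 * g w.2) volume :=
    (hf.1.comp_quasiMeasurePreserving Measure.quasiMeasurePreserving_fst).mul
      (hg.1.comp_quasiMeasurePreserving Measure.quasiMeasurePreserving_snd)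
  have hkm : Measurable (kernel δ : Eucl n × Eucl n → ℂ) := (continuous_kernel hδ0).measurable
  have hbound : ∀ x, ∫⁻ w, ‖kernelIntegrand δ f g x w‖ₑ ≤ ENNReal.ofReal C * (A x * B x) := by
    intro x
    have h3 : A x * B x = ∫⁻ w : Eucl n × Eucl n,
        (Φ (x - w.1) * ‖f w.1‖ₑ) * (Φ (x - w.2) * ‖g w.2‖ₑ) := by
      rw [Measure.volume_eq_prod, lintegral_prod_mul (f := fun y => Φ (x - y) * ‖f y‖ₑ)
        (g := fun y => Φ (x - y) * ‖g y‖ₑ)]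
      · exact (by fun_prop : Measurable fun y => Φ (x - y)).aemeasurable.mul hf.1.enorm
      · exact (by fun_prop : Measurable fun y => Φ (x - y)).aemeasurable.mul hg.1.enorm
    rw [h3, ← lintegral_const_mul' _ _ ENNReal.ofReal_ne_top]
    refine lintegral_mono fun w => ?_
    have h4 : ‖kernel δ (x - w.1, x - w.2)‖ₑ ≤
        ENNReal.ofReal C * (Φ (x - w.1) * Φ (x - w.2)) := by
      rw [hΦ]
      simp only
      rw [← enorm_mul, ← ofReal_norm, ← ofReal_norm,
        ← ENNReal.ofReal_mul hC.le]
      refine ENNReal.ofReal_le_ofReal ((hK _).trans_eq ?_)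
      rw [Real.norm_of_nonneg (by positivity)]
    rw [kernelIntegrand, enorm_mul, enorm_mul]
    calc _ ≤ ENNReal.ofReal C * (Φ (x - w.1) * Φ (x - w.2)) * ‖f w.1‖ₑ * ‖g w.2‖ₑ := by gcongr
      _ = _ := by ring
  have hsm : AEStronglyMeasurable (kernelOp δ f g) volume := by
    have h5 : AEStronglyMeasurable (fun q : Eucl n × (Eucl n × Eucl n) =>
        kernelIntegrand δ f g q.1 q.2) (volume.prod volume) := by
      simp only [kernelIntegrand, mul_assoc]
      refine AEStronglyMeasurable.mul (Measurable.aestronglyMeasurable ?_) ?_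
      · exact hkm.comp (by fun_prop)
      · exact hfgm.comp_quasiMeasurePreserving Measure.quasiMeasurePreserving_snd
    exact h5.integral_prod_right'
  -- `A` and `B` are finite almost everywhere, so real-valued versions with the same norms serve in
  -- Hölder's inequality.
  set a : Eucl n → ℝ := fun x => (A x).toReal with ha
  set b : Eucl n → ℝ := fun x => (B x).toReal with hb
  have hAf := hfin f p₁ h₁ hf
  have hBf := hfin g p₂ h₂ hg
  have haA : eLpNorm a p₁ volume = eLpNorm A p₁ volume := by
    refine eLpNorm_congr_enorm_ae ?_
    filter_upwards [hAf] with x hx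
    rw [ha, enorm_eq_self, Real.enorm_of_nonneg ENNReal.toReal_nonneg, ENNReal.ofReal_toReal hx.ne]
  have hbB : eLpNorm b p₂ volume = eLpNorm B p₂ volume := by
    refine eLpNorm_congr_enorm_ae ?_
    filter_upwards [hBf] with x hx
    rw [hb, enorm_eq_self, Real.enorm_of_nonneg ENNReal.toReal_nonneg, ENNReal.ofReal_toReal hx.ne]
  have hab : ∀ᵐ x, ‖kernelOp δ f g x‖ ≤ C * ‖a x * b x‖ := by
    filter_upwards [hAf, hBf] with x hxA hxB
    have h6 : ‖kernelOp δ f g x‖ₑ ≤ ENNReal.ofReal C * (A x * B x) :=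
      (enorm_integral_le_lintegral_enorm _).trans (hbound x)
    have h7 := ENNReal.toReal_mono (by finiteness) h6
    rw [toReal_enorm, ENNReal.toReal_mul, ENNReal.toReal_mul, ENNReal.toReal_ofReal hC.le] at h7
    rwa [Real.norm_of_nonneg (by positivity)]
  have hnorm : eLpNorm (kernelOp δ f g) p volume ≤
      (C.toNNReal * (I.toNNReal * I.toNNReal) : ℝ≥0) * eLpNorm f p₁ volume *
        eLpNorm g p₂ volume := by
    have : ENNReal.HolderTriple p₁ p₂ p := ⟨hp.symm⟩
    calc eLpNorm (kernelOp δ f g) p volume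
        ≤ ENNReal.ofReal C * eLpNorm (fun x => a x * b x) p volume :=
          eLpNorm_le_mul_eLpNorm_of_ae_le_mul hab p
      _ ≤ ENNReal.ofReal C * (eLpNorm a p₁ volume * eLpNorm b p₂ volume) := by
          gcongr
          have := eLpNorm_smul_le_mul_eLpNorm (p := p₁) (q := p₂) (r := p) (μ := volume)
            (f := b) (φ := a) (hmeas g p₂ hg).ennreal_toReal.aestronglyMeasurable
            (hmeas f p₁ hf).ennreal_toReal.aestronglyMeasurable
          exact this
      _ ≤ ENNReal.ofReal C * ((I * eLpNorm f p₁ volume) * (I * eLpNorm g p₂ volume)) := by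
          rw [haA, hbB]
          gcongr
          · exact key f p₁ h₁ hf
          · exact key g p₂ h₂ hg
      _ = _ := by
          push_cast
          rw [ENNReal.coe_toNNReal hI', ENNReal.ofReal]
          ring
  refine ⟨?_, ⟨hsm, hnorm.trans_lt ?_⟩, hnorm⟩
  · filter_upwards [hAf, hBf] with x hxA hxB
    refine ⟨?_, (hbound x).trans_lt (by finiteness)⟩
    have h8 : AEStronglyMeasurable (fun w : Eucl n × Eucl n =>
        kernel δ (x - w.1, x - w.2) * (f w.1 * g w.2)) volume :=
      (hkm.comp (by fun_prop)).aestronglyMeasurable.mul hfgm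
    refine h8.congr (Eventually.of_forall fun w => ?_)
    simp only [kernelIntegrand, mul_assoc]
  · exact ENNReal.mul_lt_top (ENNReal.mul_lt_top ENNReal.coe_lt_top hf.2) hg.2

lemma hasBoundedKernelExtension (hn : 1 ≤ n) {δ : ℝ} (hδ : (n : ℝ) - 1 / 2 < δ)
    {p₁ p₂ p : ℝ≥0∞} (h₁ : 1 ≤ p₁) (h₂ : 1 ≤ p₂) (hp : p⁻¹ = p₁⁻¹ + p₂⁻¹) :
    HasBoundedKernelExtension n δ p₁ p₂ p := by
  have hn' : (1 : ℝ) ≤ n := by exact_mod_cast hn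
  exact ⟨fun f g hf hg x => kernelOp_eq_bochnerRiesz (by linarith) hf hg x,
    exists_kernelOp_bound hn hδ h₁ h₂ hp⟩

lemma HasBoundedKernelExtension.isBoundedOnSchwartz {δ : ℝ} {p₁ p₂ p : ℝ≥0∞}
    (h : HasBoundedKernelExtension n δ p₁ p₂ p) : IsBoundedOnSchwartz n δ p₁ p₂ p := by
  obtain ⟨h1, C, hC⟩ := h
  refine ⟨C, fun f g => ?_⟩
  have h2 := (hC f g (f.memLp p₁ volume) (g.memLp p₂ volume)).2.2
  rwa [funext (h1 f g f.integrable g.integrable)] at h2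

/-! ### Unboundedness for small `p`: the kernel on the diagonal. -/

lemma exists_schwartz_fourier_eq {χ : Eucl n → ℂ} (h₁ : HasCompactSupport χ)
    (h₂ : ContDiff ℝ (⊤ : ℕ∞) χ) : ∃ f : 𝓢(Eucl n, ℂ), 𝓕 (f : Eucl n → ℂ) = χ := by
  refine ⟨𝓕⁻ (h₁.toSchwartzMap h₂), ?_⟩
  rw [← SchwartzMap.fourier_coe, FourierTransform.fourier_fourierInv_eq]
  rfl

lemma exists_schwartz_fourier_eq_one (n : ℕ) :
    ∃ f : 𝓢(Eucl n, ℂ), ∀ ξ : Eucl n, ‖ξ‖ ≤ 1 → 𝓕 (f : Eucl n → ℂ) ξ = 1 := by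
  let φ : ContDiffBump (0 : Eucl n) := ⟨1, 2, one_pos, one_lt_two⟩
  obtain ⟨f, hf⟩ := exists_schwartz_fourier_eq (χ := fun ξ => (φ ξ : ℂ))
    (φ.hasCompactSupport.comp_left Complex.ofReal_zero)
    (Complex.ofRealCLM.contDiff.comp φ.contDiff)
  refine ⟨f, fun ξ hξ => ?_⟩
  simp only [hf]
  rw [φ.one_of_mem_closedBall (by simpa using hξ), Complex.ofReal_one]

/-- Comparison of a critical weighted square with a power. -/
lemma sq_mul_weight_le {y r b C p d : ℝ} (hy : 0 ≤ y) (hr : 0 ≤ r) (hp : 0 < p) (hp2 : p ≤ 2)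
    (hyC : y ≤ C * (1 + r) ^ (-b)) (hC : 0 ≤ C) (hbp : b * p ≤ d) (hν : 0 ≤ b - d / 2) :
    y ^ 2 * (1 + r ^ 2) ^ (b - d / 2) ≤ C ^ (2 - p) * y ^ p := by
  have h1 : y ^ 2 = y ^ p * y ^ (2 - p) := by
    rw [← Real.rpow_add_of_nonneg hy hp.le (by linarith), add_sub_cancel, Real.rpow_ofNat]
  have h2 : y ^ (2 - p) ≤ C ^ (2 - p) * (1 + r) ^ (-b * (2 - p)) := by
    rw [Real.rpow_mul (by positivity), ← Real.mul_rpow hC (by positivity)]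
    exact Real.rpow_le_rpow hy hyC (by linarith)
  have h3 : (1 + r ^ 2) ^ (b - d / 2) ≤ (1 + r) ^ (2 * b - d) := by
    rw [show 2 * b - d = 2 * (b - d / 2) by ring, Real.rpow_mul (by positivity), Real.rpow_ofNat]
    exact Real.rpow_le_rpow (by positivity) (by nlinarith) hν
  -- The exponents add up to `b p - d ≤ 0`.
  have h4 : (1 + r) ^ (-b * (2 - p)) * (1 + r) ^ (2 * b - d) ≤ 1 := by
    rw [← Real.rpow_add (by positivity)]
    exact Real.rpow_le_one_of_one_le_of_nonpos (by linarith) (by linarith)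
  calc y ^ 2 * (1 + r ^ 2) ^ (b - d / 2)
      ≤ (y ^ p * (C ^ (2 - p) * (1 + r) ^ (-b * (2 - p)))) * (1 + r) ^ (2 * b - d) := by
        rw [h1]; gcongr
    _ = C ^ (2 - p) * y ^ p * ((1 + r) ^ (-b * (2 - p)) * (1 + r) ^ (2 * b - d)) := by ring
    _ ≤ C ^ (2 - p) * y ^ p * 1 := by gcongr
    _ = _ := mul_one _

/-- The symbol only sees frequencies in the unit ball, where both transforms are 1; the phase
`x·(ξ+η)` is that of the kernel at `(x, x)`. -/
lemma bochnerRiesz_eq_kernel_diag (δ : ℝ) {f g : Eucl n → ℂ} (hf : ∀ ξ, ‖ξ‖ ≤ 1 → 𝓕 f ξ = 1)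
    (hg : ∀ ξ, ‖ξ‖ ≤ 1 → 𝓕 g ξ = 1) (x : Eucl n) :
    bochnerRiesz δ f g x = kernel δ (x, x) := by
  rw [bochnerRiesz_eq, kernel_eq_integral]
  refine integral_congr_ae (Eventually.of_forall fun ζ => ?_)
  simp only [inner_add_right]
  rcases le_or_gt (‖ζ.1‖ ^ 2 + ‖ζ.2‖ ^ 2) 1 with h | h
  · rw [hf, hg, mul_one, mul_one] <;>
      nlinarith [norm_nonneg ζ.1, norm_nonneg ζ.2, sq_nonneg ‖ζ.1‖, sq_nonneg ‖ζ.2‖]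
  · rw [ballSymbol_of_lt h]
    simp

lemma norm_toLp_diag (x : Eucl n) : ‖WithLp.toLp 2 (x, x)‖ = √2 * ‖x‖ := by
  rw [WithLp.prod_norm_eq_of_L2]
  change √(‖x‖ ^ 2 + ‖x‖ ^ 2) = _
  rw [← two_mul, Real.sqrt_mul zero_le_two, Real.sqrt_sq (norm_nonneg x)]

/-- The restriction of the kernel to the diagonal is not in `L^p` for small `p`. -/
lemma not_memLp_kernel_diag (hn : 1 ≤ n) {δ : ℝ} (hδ : 0 ≤ δ) {p : ℝ≥0∞} (hp0 : p ≠ 0)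
    (hp : p ≤ ENNReal.ofReal (2 * n / (2 * n + 2 * δ + 1))) :
    ¬ MemLp (fun x : Eucl n => kernel δ (x, x)) p volume := by
  intro hmem
  have : Nonempty (Fin n) := ⟨⟨0, hn⟩⟩
  have : Nontrivial (WithLp 2 (Eucl n × Eucl n)) := (WithLp.equiv 2 _).nontrivial
  have hn' : (1 : ℝ) ≤ n := by exact_mod_cast hn
  have hpt : p ≠ ∞ := (hp.trans_lt ENNReal.ofReal_lt_top).ne
  set r := p.toReal with hr
  have hr0 : 0 < r := ENNReal.toReal_pos hp0 hpt
  have hden : 0 < 2 * (n : ℝ) + 2 * δ + 1 := by positivity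
  have hr1 : r ≤ 2 * n / (2 * n + 2 * δ + 1) :=
    ENNReal.toReal_le_of_le_ofReal (by positivity) hp
  -- The hypothesis on `p` says that the decay exponent times `p` is at most the dimension, the
  -- condition for failing to be `p`-integrable on `ℝⁿ`.
  have hbr : (δ + (2 * n + 1) / 2) * r ≤ n := by
    rw [le_div_iff₀ hden] at hr1
    linarith
  have hr2 : r ≤ 2 := hr1.trans (by rw [div_le_iff₀ hden]; nlinarith)
  have hinteg := hmem.integrable_norm_rpow hp0 hpt
  obtain ⟨C, hC, hK⟩ := exists_norm_ballKernel_le (V := WithLp 2 (Eucl n × Eucl n)) hδ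
  refine not_integrable_ballKernel_sq (V := Eucl n) (W := WithLp 2 (Eucl n × Eucl n)) hδ
    (r := √2) (by positivity) (L := fun x => WithLp.toLp 2 (x, x)) norm_toLp_diag ?_
  have hcont : Continuous fun x : Eucl n => ballKernel 1 δ (WithLp.toLp 2 (x, x)) :=
    ((continuous_kernel hδ).comp (by fun_prop : Continuous fun x : Eucl n => (x, x))).congr
      fun x => kernel_eq_ballKernel δ (x, x)
  refine (hinteg.const_mul (C ^ (2 - r))).mono' ?_ (Eventually.of_forall fun x => ?_)
  · refine Measurable.aestronglyMeasurable ?_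
    have := hcont.measurable
    fun_prop
  rw [Real.norm_of_nonneg (by positivity), kernel_eq_ballKernel, finrank_withLp_prod,
    finrank_euclideanSpace_fin]
  push_cast
  refine sq_mul_weight_le (norm_nonneg _) (norm_nonneg _) hr0 hr2 ((hK _).trans ?_) hC.le hbr
    (by linarith)
  rw [finrank_withLp_prod, norm_toLp_diag]
  push_cast
  refine mul_le_mul_of_nonneg_left (Real.rpow_le_rpow_of_nonpos (by positivity) ?_ ?_) hC.le
  · nlinarith [norm_nonneg x, Real.one_lt_sqrt_two]
  · rw [neg_nonpos]; positivity

/-- One fixed Schwartz pair suffices: the right-hand side is finite for all `p₁`, `p₂`, while the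
left-hand side is the infinite norm of the diagonal kernel. -/
lemma not_isBoundedOnSchwartz_of_le (hn : 1 ≤ n) {δ : ℝ} (hδ : 0 ≤ δ) {p₁ p₂ p : ℝ≥0∞}
    (hp0 : p ≠ 0) (hp : p ≤ ENNReal.ofReal (2 * n / (2 * n + 2 * δ + 1))) :
    ¬ IsBoundedOnSchwartz n δ p₁ p₂ p := by
  rintro ⟨C, hC⟩
  obtain ⟨f, hf⟩ := exists_schwartz_fourier_eq_one n
  have h := hC f f
  rw [funext (bochnerRiesz_eq_kernel_diag δ hf hf)] at h
  refine not_memLp_kernel_diag hn hδ hp0 hp ⟨?_, h.trans_lt ?_⟩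
  · exact ((continuous_kernel hδ).comp
      (by fun_prop : Continuous fun x : Eucl n => (x, x))).aestronglyMeasurable
  · exact ENNReal.mul_lt_top (ENNReal.mul_lt_top ENNReal.coe_lt_top (f.memLp p₁ volume).2)
      (f.memLp p₂ volume).2

/-! ### Failure of the dual estimate for linear kernels. -/

lemma exists_norm_ballKernel_scaled_le (hn : 1 ≤ n) {δ : ℝ} (hδ : 0 ≤ δ) {a : ℝ} (ha : 0 < a) :
    ∃ C : ℝ, 0 < C ∧ ∀ x : Eucl n, ‖ballKernel a δ x‖ ≤
      C * (1 + ‖x‖) ^ (-(δ + (n + 1) / 2)) := by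
  have : Nonempty (Fin n) := ⟨⟨0, hn⟩⟩
  obtain ⟨C, hC, h⟩ := exists_norm_ballKernel_le (V := Eucl n) hδ
  rw [finrank_euclideanSpace_fin] at h
  set b := δ + ((n : ℝ) + 1) / 2 with hb
  have hb0 : 0 ≤ b := by positivity
  set c := (√a)⁻¹ with hc
  have hc0 : 0 < c := by positivity
  set m := min 1 c with hm
  have hm0 : 0 < m := lt_min one_pos hc0
  refine ⟨c ^ n * C * m ^ (-b), by positivity, fun x => ?_⟩
  rw [ballKernel_scale ha, finrank_euclideanSpace_fin, norm_mul, Complex.norm_real,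
    Real.norm_of_nonneg (by positivity), mul_assoc, mul_assoc]
  refine mul_le_mul_of_nonneg_left ((h _).trans (mul_le_mul_of_nonneg_left ?_ hC.le))
    (by positivity)
  rw [← Real.mul_rpow hm0.le (by positivity), norm_smul, Real.norm_of_nonneg hc0.le]
  refine Real.rpow_le_rpow_of_nonpos (by positivity) ?_ (by linarith)
  have h1 : m ≤ 1 := min_le_left _ _
  have h2 : m ≤ c := min_le_right _ _
  nlinarith [norm_nonneg x]

lemma not_integrable_ballKernel_scaled_sq (hn : 1 ≤ n) {δ : ℝ} (hδ : 0 ≤ δ) {a : ℝ}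
    (ha : 0 < a) :
    ¬ Integrable (fun x : Eucl n => ‖ballKernel a δ x‖ ^ 2 *
      (1 + ‖x‖ ^ 2) ^ (δ + (n + 1) / 2 - n / 2 : ℝ)) := by
  have : Nonempty (Fin n) := ⟨⟨0, hn⟩⟩
  have hc0 : 0 < (√a)⁻¹ := by positivity
  intro hinteg
  refine not_integrable_ballKernel_sq (V := Eucl n) (W := Eucl n) hδ hc0
    (L := fun x => (√a)⁻¹ • x) (fun x => by rw [norm_smul, Real.norm_of_nonneg hc0.le]) ?_
  rw [finrank_euclideanSpace_fin]
  refine (hinteg.const_mul ((((√a)⁻¹ ^ n) ^ 2)⁻¹)).congr (Eventually.of_forall fun x => ?_)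
  simp only
  rw [ballKernel_scale ha, finrank_euclideanSpace_fin, norm_mul, Complex.norm_real,
    Real.norm_of_nonneg (by positivity), mul_pow, mul_assoc, ← mul_assoc,
    inv_mul_cancel₀ (by positivity), one_mul]

/-- The case `q = ∞` of the test function estimate: kernel decay times critical weight has total
exponent `b - d ≤ 0`. -/
lemma mul_weight_le {y r b C d : ℝ} (hr : 0 ≤ r) (hyC : y ≤ C * (1 + r) ^ (-b)) (hC : 0 ≤ C)
    (hbd : b ≤ d) (hν : 0 ≤ b - d / 2) : y * (1 + r ^ 2) ^ (b - d / 2) ≤ C := by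
  have h3 : (1 + r ^ 2) ^ (b - d / 2) ≤ (1 + r) ^ (2 * b - d) := by
    rw [show 2 * b - d = 2 * (b - d / 2) by ring, Real.rpow_mul (by positivity), Real.rpow_ofNat]
    exact Real.rpow_le_rpow (by positivity) (by nlinarith) hν
  calc y * (1 + r ^ 2) ^ (b - d / 2) ≤ C * (1 + r) ^ (-b) * (1 + r) ^ (2 * b - d) := by gcongr
    _ = C * (1 + r) ^ (b - d) := by
        rw [mul_assoc, ← Real.rpow_add (by positivity)]
        ring_nf
    _ ≤ C * 1 := by
        gcongr
        exact Real.rpow_le_one_of_one_le_of_nonpos (by linarith) (by linarith)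
    _ = C := mul_one C

/-- For finite `q`: the `q`-th power of the test function is controlled by the weighted square it is
tested on. Beyond one factor `y² W θ`, the remaining exponents add up to `bq - d(q - 1) ≤ 0`. -/
lemma mul_weight_rpow_le {y r b C d q θ : ℝ} (hy : 0 ≤ y) (hr : 0 ≤ r) (hq : 2 ≤ q)
    (hθ0 : 0 ≤ θ) (hθ1 : θ ≤ 1) (hyC : y ≤ C * (1 + r) ^ (-b)) (hC : 0 ≤ C)
    (hbq : b * q ≤ d * (q - 1)) (hν : 0 ≤ b - d / 2) :
    (y * ((1 + r ^ 2) ^ (b - d / 2) * θ)) ^ q ≤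
      C ^ (q - 2) * (y ^ 2 * (1 + r ^ 2) ^ (b - d / 2) * θ) := by
  set W := (1 + r ^ 2) ^ (b - d / 2) with hW
  have hW0 : 0 < W := by positivity
  have h1 : y ^ q = y ^ 2 * y ^ (q - 2) := by
    rw [← Real.rpow_ofNat y 2, ← Real.rpow_add_of_nonneg hy (by norm_num) (by linarith)]
    ring_nf
  have h2 : W ^ q = W * W ^ (q - 1) := by
    rw [← Real.rpow_one_add' hW0.le (by linarith)]
    ring_nf
  have h3 : θ ^ q ≤ θ := by
    simpa using Real.rpow_le_rpow_of_exponent_ge_of_imp hθ0 hθ1 (show (1 : ℝ) ≤ q by linarith)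
      (by intro _ h; linarith)
  have h4 : y ^ (q - 2) ≤ C ^ (q - 2) * (1 + r) ^ (-b * (q - 2)) := by
    rw [Real.rpow_mul (by positivity), ← Real.mul_rpow hC (by positivity)]
    exact Real.rpow_le_rpow hy hyC (by linarith)
  have h5 : W ^ (q - 1) ≤ (1 + r) ^ ((2 * b - d) * (q - 1)) := by
    rw [Real.rpow_mul (by positivity)]
    refine Real.rpow_le_rpow hW0.le ?_ (by linarith)
    rw [show 2 * b - d = 2 * (b - d / 2) by ring, Real.rpow_mul (by positivity), Real.rpow_ofNat]
    exact Real.rpow_le_rpow (by positivity) (by nlinarith) hν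
  have h6 : (1 + r) ^ (-b * (q - 2)) * (1 + r) ^ ((2 * b - d) * (q - 1)) ≤ 1 := by
    rw [← Real.rpow_add (by positivity)]
    exact Real.rpow_le_one_of_one_le_of_nonpos (by linarith) (by nlinarith)
  rw [Real.mul_rpow hy (by positivity), Real.mul_rpow hW0.le hθ0, h1, h2]
  calc y ^ 2 * y ^ (q - 2) * (W * W ^ (q - 1) * θ ^ q)
      ≤ y ^ 2 * (C ^ (q - 2) * (1 + r) ^ (-b * (q - 2))) *
          (W * (1 + r) ^ ((2 * b - d) * (q - 1)) * θ) := by gcongr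
    _ = C ^ (q - 2) * (y ^ 2 * W * θ) *
          ((1 + r) ^ (-b * (q - 2)) * (1 + r) ^ ((2 * b - d) * (q - 1))) := by ring
    _ ≤ C ^ (q - 2) * (y ^ 2 * W * θ) * 1 := by gcongr
    _ = _ := mul_one _

/-- Integration against the Bochner-Riesz kernel is not bounded on `L^q` in the critical range. -/
lemma not_exists_bound_integral_ballKernel_mul (hn : 1 ≤ n) {δ : ℝ} (hδ : 0 ≤ δ) {a : ℝ}
    (ha : 0 < a) {q : ℝ≥0∞} (hq : 2 ≤ q)
    (hb : δ + (n + 1) / 2 ≤ n * (1 - (q⁻¹).toReal)) :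
    ¬ ∃ C : ℝ≥0, ∀ g : 𝓢(Eucl n, ℂ),
      ‖∫ x, ballKernel a δ x * g x‖ₑ ≤ C * eLpNorm g q volume := by
  rintro ⟨M, hM⟩
  obtain ⟨C, hC, hK⟩ := exists_norm_ballKernel_scaled_le hn hδ ha
  set K : Eucl n → ℂ := ballKernel a δ with hKdef
  have hKs : ContDiff ℝ (⊤ : ℕ∞) K := contDiff_ballKernel ha hδ
  set b := δ + ((n : ℝ) + 1) / 2 with hbdef
  have hν : 0 ≤ b - n / 2 := by rw [hbdef]; linarith
  set N : Eucl n → ℝ := fun x => ‖K x‖ ^ 2 * (1 + ‖x‖ ^ 2) ^ (b - n / 2) with hN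
  have hWs : ContDiff ℝ (⊤ : ℕ∞) fun x : Eucl n => (1 + ‖x‖ ^ 2) ^ (b - n / 2) :=
    (contDiff_const.add (contDiff_norm_sq ℝ)).rpow_const_of_ne fun x => by positivity
  have hNc : Continuous N := (hKs.continuous.norm.pow 2).mul hWs.continuous
  have hN0 : ∀ x, 0 ≤ N x := fun x => by positivity
  -- Uniformly bounded truncations would make the critical weighted square integrable.
  suffices hbd : ∃ B : ℝ, ∀ R : ℝ, 0 < R → ∫ x in Metric.closedBall 0 R, N x ≤ B by
    obtain ⟨B, hB⟩ := hbd
    refine not_integrable_ballKernel_scaled_sq hn hδ ha ?_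
    refine (aecover_closedBall (x := (0 : Eucl n)) (μ := volume) (r := fun k : ℕ => (k : ℝ) + 1)
      (l := atTop) (tendsto_atTop_add_const_right _ _ tendsto_natCast_atTop_atTop)
      ).integrable_of_integral_bounded_of_nonneg_ae B
      (fun k => hNc.continuousOn.integrableOn_compact (isCompact_closedBall _ _))
      (Eventually.of_forall hN0) (Eventually.of_forall fun k => hB _ (by positivity))
  set D : ℝ := C ^ (q.toReal - 2) with hD
  have hD0 : 0 < D := by positivity
  -- The sum covers all cases: `M * C` for `q = ∞`, and for finite `q` either `1 / D` (when `D I ≤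
  -- 1`) or `M ^ 2 * D` (from `I ≤ M √(D I)`).
  refine ⟨M * C + (M ^ 2 * D + 1 / D), fun R hR => ?_⟩
  let φ : ContDiffBump (0 : Eucl n) := ⟨R, R + 1, hR, by linarith⟩
  -- The conjugate kernel times the truncated critical weight, so that pairing with `K` gives the
  -- truncated integral `I` of `N`.
  set g : Eucl n → ℂ := fun x =>
    (starRingEnd ℂ) (K x) * (((1 + ‖x‖ ^ 2) ^ (b - n / 2) * φ x : ℝ) : ℂ) with hg
  have hgs : ContDiff ℝ (⊤ : ℕ∞) g :=
    (Complex.conjCLE.contDiff.comp hKs).mul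
      (Complex.ofRealCLM.contDiff.comp (hWs.mul φ.contDiff))
  have hgc : HasCompactSupport g := by
    refine HasCompactSupport.mul_left (HasCompactSupport.comp_left (g := fun t : ℝ => (t : ℂ))
      ?_ Complex.ofReal_zero)
    exact φ.hasCompactSupport.mul_left
  have hNφc : Continuous fun x => N x * φ x := hNc.mul φ.continuous
  have hNφi : Integrable fun x => N x * φ x :=
    hNφc.integrable_of_hasCompactSupport φ.hasCompactSupport.mul_left
  set I := ∫ x, N x * φ x with hI
  have hI0 : 0 ≤ I := integral_nonneg fun x => mul_nonneg (hN0 x) φ.nonneg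
  have hle : ∫ x in Metric.closedBall 0 R, N x ≤ I := by
    calc ∫ x in Metric.closedBall 0 R, N x = ∫ x in Metric.closedBall 0 R, N x * φ x := by
          refine setIntegral_congr_fun Metric.isClosed_closedBall.measurableSet fun x hx => ?_
          rw [φ.one_of_mem_closedBall hx, mul_one]
      _ ≤ I := setIntegral_le_integral hNφi
          (Eventually.of_forall fun x => mul_nonneg (hN0 x) φ.nonneg)
  refine hle.trans ?_
  have hKg : ∫ x, K x * g x = (I : ℂ) := by
    rw [hI, ← integral_complex_ofReal]
    refine integral_congr_ae (Eventually.of_forall fun x => ?_)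
    simp only [hg, hN]
    rw [← mul_assoc, Complex.mul_conj, Complex.normSq_eq_norm_sq]
    push_cast
    ring
  have hgn : ∀ x, ‖g x‖ = ‖K x‖ * ((1 + ‖x‖ ^ 2) ^ (b - n / 2) * φ x) := by
    intro x
    rw [hg]
    simp only
    rw [norm_mul, RCLike.norm_conj, Complex.norm_real, Real.norm_of_nonneg]
    exact mul_nonneg (by positivity) φ.nonneg
  have hMg := hM (hgc.toSchwartzMap hgs)
  have hcoe : ((hgc.toSchwartzMap hgs : 𝓢(Eucl n, ℂ)) : Eucl n → ℂ) = g := rfl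
  rw [hcoe, hKg, ← ofReal_norm, Complex.norm_real, Real.norm_of_nonneg hI0] at hMg
  rcases eq_or_ne q ∞ with rfl | hqt
  · have h1 : eLpNorm g ∞ volume ≤ ENNReal.ofReal C := by
      refine eLpNormEssSup_le_of_ae_bound (Eventually.of_forall fun x => ?_)
      rw [hgn, ← mul_assoc]
      have h2 := mul_weight_le (norm_nonneg x) (hK x) hC.le
        (show b ≤ n by simpa using hb) hν
      calc _ ≤ C * 1 := mul_le_mul h2 φ.le_one φ.nonneg hC.le
        _ = C := mul_one C
    have h2 : ENNReal.ofReal I ≤ ENNReal.ofReal (M * C) := by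
      rw [ENNReal.ofReal_mul M.coe_nonneg, ENNReal.ofReal_coe_nnreal]
      exact hMg.trans (by gcongr)
    rw [ENNReal.ofReal_le_ofReal_iff (by positivity)] at h2
    have : 0 ≤ (M : ℝ) ^ 2 * D + 1 / D := by positivity
    linarith
  · have hq0 : q ≠ 0 := (two_pos.trans_le hq).ne'
    set r := q.toReal with hr
    have hr2 : 2 ≤ r := by
      rw [hr]
      simpa using ENNReal.toReal_mono hqt hq
    have hr0 : 0 < r := by linarith
    rw [ENNReal.toReal_inv, ← hr] at hb
    have hbr : b * r ≤ n * (r - 1) := by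
      calc b * r ≤ n * (1 - r⁻¹) * r := by gcongr
        _ = n * (r - 1) := by field_simp
    have h1 : eLpNorm g q volume ≤ ENNReal.ofReal ((D * I) ^ (1 / r)) := by
      rw [eLpNorm_eq_lintegral_rpow_enorm_toReal hq0 hqt, ← hr,
        ← ENNReal.ofReal_rpow_of_nonneg (by positivity) (by positivity)]
      refine ENNReal.rpow_le_rpow ?_ (by positivity)
      rw [hI, ← integral_const_mul, ofReal_integral_eq_lintegral_ofReal (hNφi.const_mul D)
        (Eventually.of_forall fun x => mul_nonneg hD0.le (mul_nonneg (hN0 x) φ.nonneg))]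
      refine lintegral_mono fun x => ?_
      rw [← ofReal_norm, ENNReal.ofReal_rpow_of_nonneg (norm_nonneg _) hr0.le, hgn]
      exact ENNReal.ofReal_le_ofReal (mul_weight_rpow_le (norm_nonneg _) (norm_nonneg _) hr2
        φ.nonneg φ.le_one (hK x) hC.le hbr hν)
    have h2 : ENNReal.ofReal I ≤ ENNReal.ofReal (M * (D * I) ^ (1 / r)) := by
      rw [ENNReal.ofReal_mul M.coe_nonneg, ENNReal.ofReal_coe_nnreal]
      exact hMg.trans (by gcongr)
    rw [ENNReal.ofReal_le_ofReal_iff (by positivity)] at h2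
    have hMC : 0 ≤ (M : ℝ) * C := by positivity
    have hM2 : 0 ≤ (M : ℝ) ^ 2 * D := by positivity
    rcases le_or_gt (D * I) 1 with h3 | h3
    · have : I ≤ 1 / D := by
        rw [le_div_iff₀ hD0]
        linarith
      linarith
    · have h4 : (D * I) ^ (1 / r) ≤ √(D * I) := by
        rw [Real.sqrt_eq_rpow]
        refine Real.rpow_le_rpow_of_exponent_le h3.le ?_
        gcongr
      have h5 : I ≤ M * √(D * I) := h2.trans (by gcongr)
      have h6 : I ^ 2 ≤ M ^ 2 * (D * I) := by
        calc I ^ 2 ≤ (M * √(D * I)) ^ 2 := pow_le_pow_left₀ hI0 h5 2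
          _ = _ := by rw [mul_pow, Real.sq_sqrt (by positivity)]
      have hIpos : 0 < I := by
        by_contra! h7
        nlinarith
      have h8 : I ≤ M ^ 2 * D := by
        by_contra! h9
        nlinarith
      have : 0 < 1 / D := by positivity
      linarith

/-! ### The trilinear form and its slices. -/

lemma integrable_fourier_schwartz (f : 𝓢(Eucl n, ℂ)) : Integrable (𝓕 (f : Eucl n → ℂ)) := by
  rw [← SchwartzMap.fourier_coe]
  exact (𝓕 f).integrable

lemma continuous_fourier_schwartz (f : 𝓢(Eucl n, ℂ)) : Continuous (𝓕 (f : Eucl n → ℂ)) := by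
  rw [← SchwartzMap.fourier_coe]
  exact (𝓕 f).continuous

lemma exists_norm_fourier_schwartz_le (f : 𝓢(Eucl n, ℂ)) :
    ∃ B : ℝ, 0 ≤ B ∧ ∀ ξ, ‖𝓕 (f : Eucl n → ℂ) ξ‖ ≤ B := by
  obtain ⟨B, hB, h⟩ := (𝓕 f).decay 0 0
  refine ⟨B, hB.le, fun ξ => ?_⟩
  rw [← SchwartzMap.fourier_coe]
  simpa using h ξ

lemma eLpNorm_top_le_lintegral_fourier (g : 𝓢(Eucl n, ℂ)) :
    eLpNorm g ∞ volume ≤ ∫⁻ ξ, ‖𝓕 (g : Eucl n → ℂ) ξ‖ₑ := by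
  rw [eLpNorm_exponent_top]
  refine essSup_le_of_ae_le _ (Eventually.of_forall fun x => ?_)
  simp only
  have h : g x = 𝓕⁻ (𝓕 (g : Eucl n → ℂ)) x := by
    rw [← SchwartzMap.fourier_coe, ← SchwartzMap.fourierInv_coe,
      FourierTransform.fourierInv_fourier_eq]
  rw [h, Real.fourierInv_eq']
  refine (enorm_integral_le_lintegral_enorm _).trans (lintegral_mono fun ξ => ?_)
  rw [enorm_smul, ← ofReal_norm, Complex.norm_exp_ofReal_mul_I, ENNReal.ofReal_one, one_mul]

/-- A Schwartz function of sup norm at most one whose Fourier transform is a given normalized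
bump function. -/
lemma exists_schwartz_fourier_eq_normed (φ : ContDiffBump (0 : Eucl n)) :
    ∃ g : 𝓢(Eucl n, ℂ), (∀ ξ, 𝓕 (g : Eucl n → ℂ) ξ = (φ.normed volume ξ : ℂ)) ∧
      eLpNorm g ∞ volume ≤ 1 := by
  obtain ⟨g, hg⟩ := exists_schwartz_fourier_eq (χ := fun ξ => (φ.normed volume ξ : ℂ))
    (φ.hasCompactSupport_normed.comp_left Complex.ofReal_zero)
    (Complex.ofRealCLM.contDiff.comp φ.contDiff_normed)
  refine ⟨g, fun ξ => by rw [hg], (eLpNorm_top_le_lintegral_fourier g).trans_eq ?_⟩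
  rw [hg]
  have h : ∀ ξ, ‖(φ.normed volume ξ : ℂ)‖ₑ = ENNReal.ofReal (φ.normed volume ξ) := by
    intro ξ
    rw [← ofReal_norm, Complex.norm_real, Real.norm_of_nonneg (φ.nonneg_normed ξ)]
  simp_rw [h]
  rw [← ofReal_integral_eq_lintegral_ofReal φ.integrable_normed
    (Eventually.of_forall φ.nonneg_normed), φ.integral_normed, ENNReal.ofReal_one]

lemma norm_ballSymbol_le_one {δ t : ℝ} (hδ : 0 ≤ δ) (ht : 0 ≤ t) :
    ‖(ballSymbol δ t : ℂ)‖ ≤ 1 := by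
  rw [Complex.norm_real, Real.norm_of_nonneg (ballSymbol_nonneg _ _)]
  exact ballSymbol_le_one hδ ht

lemma integrable_trilinear_integrand {δ : ℝ} (hδ : 0 ≤ δ)
    (f g h : 𝓢(Eucl n, ℂ)) :
    Integrable (fun q : Eucl n × (Eucl n × Eucl n) =>
      Complex.exp (2 * Real.pi * Complex.I * (inner ℝ q.1 (q.2.1 + q.2.2) : ℝ)) *
        (ballSymbol δ (‖q.2.1‖ ^ 2 + ‖q.2.2‖ ^ 2) : ℝ) *
        (𝓕 (f : Eucl n → ℂ) q.2.1 * 𝓕 (g : Eucl n → ℂ) q.2.2) * h q.1)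
      (volume.prod volume) := by
  have hF := continuous_fourier_schwartz f
  have hG := continuous_fourier_schwartz g
  have hFG : Integrable fun ζ : Eucl n × Eucl n =>
      𝓕 (f : Eucl n → ℂ) ζ.1 * 𝓕 (g : Eucl n → ℂ) ζ.2 :=
    (integrable_fourier_schwartz f).mul_prod (integrable_fourier_schwartz g)
  refine (h.integrable.norm.mul_prod hFG.norm).mono' ?_ (Eventually.of_forall fun q => ?_)
  · have hh := h.continuous.measurable
    have hF' := hF.measurable
    have hG' := hG.measurable
    exact Measurable.aestronglyMeasurable (by fun_prop)
  · rw [norm_mul, norm_mul, norm_mul, norm_exp_two_pi_I_mul, one_mul, mul_comm]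
    gcongr
    calc _ ≤ 1 * _ := mul_le_mul_of_nonneg_right
          (norm_ballSymbol_le_one hδ (by positivity)) (norm_nonneg _)
      _ = _ := one_mul _

/-- The trilinear form associated with `S^δ`. -/
lemma integral_bochnerRiesz_mul {δ : ℝ} (hδ : 0 ≤ δ)
    (f g h : 𝓢(Eucl n, ℂ)) :
    ∫ x, bochnerRiesz δ f g x * h x = ∫ ζ : Eucl n × Eucl n,
      (ballSymbol δ (‖ζ.1‖ ^ 2 + ‖ζ.2‖ ^ 2) : ℝ) * (𝓕 (f : Eucl n → ℂ) ζ.1 *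
        𝓕 (g : Eucl n → ℂ) ζ.2 * 𝓕 (h : Eucl n → ℂ) (-(ζ.1 + ζ.2))) := by
  simp_rw [bochnerRiesz_eq, ← integral_mul_const]
  rw [integral_integral_swap (integrable_trilinear_integrand hδ f g h)]
  refine integral_congr_ae (Eventually.of_forall fun ζ => ?_)
  simp only
  rw [Real.fourier_eq' (h : Eucl n → ℂ), ← integral_const_mul, ← integral_const_mul]
  refine integral_congr_ae (Eventually.of_forall fun x => ?_)
  simp only [smul_eq_mul, inner_neg_right]
  have : ((-2 * Real.pi * -inner ℝ x (ζ.1 + ζ.2) : ℝ) : ℂ) * Complex.I =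
      2 * Real.pi * Complex.I * (inner ℝ x (ζ.1 + ζ.2) : ℝ) := by
    push_cast
    ring
  rw [this]
  ring

lemma aestronglyMeasurable_bochnerRiesz (δ : ℝ) (f g : 𝓢(Eucl n, ℂ)) :
    AEStronglyMeasurable (bochnerRiesz δ f g) volume := by
  have hF := (continuous_fourier_schwartz f).measurable
  have hG := (continuous_fourier_schwartz g).measurable
  have : AEStronglyMeasurable (fun q : Eucl n × (Eucl n × Eucl n) =>
      Complex.exp (2 * Real.pi * Complex.I * (inner ℝ q.1 (q.2.1 + q.2.2) : ℝ)) *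
        (ballSymbol δ (‖q.2.1‖ ^ 2 + ‖q.2.2‖ ^ 2) : ℝ) *
        (𝓕 (f : Eucl n → ℂ) q.2.1 * 𝓕 (g : Eucl n → ℂ) q.2.2)) (volume.prod volume) :=
    Measurable.aestronglyMeasurable (by fun_prop)
  exact this.integral_prod_right'.congr
    (Eventually.of_forall fun x => (bochnerRiesz_eq δ f g x).symm)

lemma enorm_integral_bochnerRiesz_mul_le (δ : ℝ)
    (f g h : 𝓢(Eucl n, ℂ)) {p p' : ℝ≥0∞} (hp : p⁻¹ + p'⁻¹ = 1) :
    ‖∫ x, bochnerRiesz δ f g x * h x‖ₑ ≤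
      eLpNorm (bochnerRiesz δ f g) p volume * eLpNorm h p' volume := by
  have : ENNReal.HolderTriple p p' 1 := ⟨by rw [hp, inv_one]⟩
  refine (enorm_integral_le_lintegral_enorm _).trans ?_
  rw [← eLpNorm_one_eq_lintegral_enorm]
  exact eLpNorm_smul_le_mul_eLpNorm (φ := bochnerRiesz δ f g) (f := h)
    h.continuous.aestronglyMeasurable (aestronglyMeasurable_bochnerRiesz δ f g)

/-- Testing against normalized bump functions shrinking to the origin. -/
lemma enorm_le_of_forall_bump {Ψ : Eucl n → ℂ} (hm : AEStronglyMeasurable Ψ volume)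
    (hΨ : ContinuousAt Ψ 0) {M : ℝ≥0∞}
    (h : ∀ φ : ContDiffBump (0 : Eucl n), ‖∫ η, (φ.normed volume η : ℂ) * Ψ η‖ₑ ≤ M) :
    ‖Ψ 0‖ₑ ≤ M := by
  let φ : ℕ → ContDiffBump (0 : Eucl n) := fun k =>
    ⟨1 / (2 * ((k : ℝ) + 1)), 1 / ((k : ℝ) + 1), by positivity, by gcongr; linarith⟩
  have hlim := ContDiffBump.convolution_tendsto_right (μ := (volume : Measure (Eucl n)))
    (φ := φ) (g := fun _ η => Ψ (-η)) (k := fun _ => 0) (x₀ := 0) (z₀ := Ψ 0) (l := atTop)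
    tendsto_one_div_add_atTop_nhds_zero_nat
    (Eventually.of_forall fun _ => hm.comp_quasiMeasurePreserving
      (Measure.measurePreserving_neg volume).quasiMeasurePreserving)
    (by
      have h1 : Tendsto (fun η : Eucl n => Ψ (-η)) (𝓝 0) (𝓝 (Ψ 0)) := by
        have h2 : Tendsto (fun η : Eucl n => -η) (𝓝 0) (𝓝 0) := by
          simpa using (continuous_neg (G := Eucl n)).tendsto 0
        exact hΨ.tendsto.comp h2
      exact h1.comp tendsto_snd)
    tendsto_const_nhds
  refine le_of_tendsto' hlim.enorm fun k => ?_
  simpa [convolution_def] using h (φ k)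

/-- The slices of the trilinear form along which one argument is localized at frequency `η`. -/
def sliceForm (δ : ℝ) (s : Eucl n × Eucl n → ℝ) (f h : Eucl n → ℂ) (η : Eucl n) : ℂ :=
  ∫ ξ, (ballSymbol δ (s (ξ, η)) : ℂ) * (𝓕 f ξ * 𝓕 h (-(ξ + η)))

lemma measurable_slice_integrand {δ : ℝ} (f h : 𝓢(Eucl n, ℂ))
    {s : Eucl n × Eucl n → ℝ} (hs : Continuous s) :
    Measurable fun q : Eucl n × Eucl n => (ballSymbol δ (s q) : ℂ) *
      (𝓕 (f : Eucl n → ℂ) q.1 * 𝓕 (h : Eucl n → ℂ) (-(q.1 + q.2))) := by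
  have hF := (continuous_fourier_schwartz f).measurable
  have hG := (continuous_fourier_schwartz h).measurable
  have hs' := hs.measurable
  fun_prop

lemma norm_slice_integrand_le {δ : ℝ} (hδ : 0 ≤ δ) (f h : 𝓢(Eucl n, ℂ))
    {s : Eucl n × Eucl n → ℝ} (hs0 : ∀ q, 0 ≤ s q) {B : ℝ}
    (hB : ∀ ξ, ‖𝓕 (h : Eucl n → ℂ) ξ‖ ≤ B) (q : Eucl n × Eucl n) :
    ‖(ballSymbol δ (s q) : ℂ) *
      (𝓕 (f : Eucl n → ℂ) q.1 * 𝓕 (h : Eucl n → ℂ) (-(q.1 + q.2)))‖ ≤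
      ‖𝓕 (f : Eucl n → ℂ) q.1‖ * B := by
  rw [norm_mul, norm_mul]
  calc _ ≤ 1 * (‖𝓕 (f : Eucl n → ℂ) q.1‖ * B) := by
        gcongr
        · exact norm_ballSymbol_le_one hδ (hs0 _)
        · exact hB _
    _ = _ := one_mul _

lemma aestronglyMeasurable_sliceForm {δ : ℝ} (f h : 𝓢(Eucl n, ℂ))
    {s : Eucl n × Eucl n → ℝ} (hs : Continuous s) :
    AEStronglyMeasurable (sliceForm δ s f h) volume := by
  have h1 := (measurable_slice_integrand (δ := δ) f h hs).comp measurable_swap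
  exact (h1.aestronglyMeasurable (μ := volume.prod volume)).integral_prod_right'

/-- Dominated convergence works even for `δ = 0`, where the symbol jumps: at `η = 0` the jump sits
on the sphere of radius `a^{-1/2}`, a null set of `ξ`. -/
lemma continuousAt_sliceForm {δ : ℝ} (hδ : 0 ≤ δ) (f h : 𝓢(Eucl n, ℂ))
    {s : Eucl n × Eucl n → ℝ} (hn : 1 ≤ n) (hs : Continuous s) (hs0 : ∀ q, 0 ≤ s q) {a : ℝ}
    (ha : 0 < a) (hsa : ∀ ξ, s (ξ, 0) = a * ‖ξ‖ ^ 2) :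
    ContinuousAt (sliceForm δ s f h) 0 := by
  have : Nonempty (Fin n) := ⟨⟨0, hn⟩⟩
  obtain ⟨B, -, hB⟩ := exists_norm_fourier_schwartz_le h
  refine continuousAt_of_dominated (bound := fun ξ => ‖𝓕 (f : Eucl n → ℂ) ξ‖ * B)
    (Eventually.of_forall fun η => ?_) (Eventually.of_forall fun η =>
      Eventually.of_forall fun ξ => norm_slice_integrand_le hδ f h hs0 hB (ξ, η))
    ((integrable_fourier_schwartz f).norm.mul_const B) ?_
  · exact ((measurable_slice_integrand (δ := δ) f h hs).comp
      (measurable_prodMk_right (y := η))).aestronglyMeasurable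
  · have hsph : ∀ᵐ ξ : Eucl n, ξ ∉ Metric.sphere (0 : Eucl n) (√a)⁻¹ :=
      measure_eq_zero_iff_ae_notMem.1 (Measure.addHaar_sphere volume _ _)
    filter_upwards [hsph] with ξ hξ
    have hne : s (ξ, 0) ≠ 1 := by
      rw [hsa]
      intro h1
      refine hξ ?_
      rw [mem_sphere_zero_iff_norm]
      have h2 : (√a * ‖ξ‖) ^ 2 = 1 := by rw [mul_pow, Real.sq_sqrt ha.le, h1]
      have h3 : √a * ‖ξ‖ = 1 := by
        have h4 : 0 ≤ √a * ‖ξ‖ := by positivity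
        nlinarith
      exact eq_inv_of_mul_eq_one_right h3
    have hH := continuous_fourier_schwartz h
    have h1 : ContinuousAt (fun η => ballSymbol δ (s (ξ, η))) 0 :=
      ContinuousAt.comp (f := fun η => s (ξ, η)) (continuousAt_ballSymbol hne)
        (hs.comp (by fun_prop)).continuousAt
    have h2 : Continuous fun η => 𝓕 (f : Eucl n → ℂ) ξ * 𝓕 (h : Eucl n → ℂ) (-(ξ + η)) :=
      continuous_const.mul (hH.comp (by fun_prop))
    exact (Complex.continuous_ofReal.continuousAt.comp h1).mul h2.continuousAt

lemma integrable_bump_mul_slice {δ : ℝ} (hδ : 0 ≤ δ) (f h : 𝓢(Eucl n, ℂ))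
    {s : Eucl n × Eucl n → ℝ} (hs : Continuous s) (hs0 : ∀ q, 0 ≤ s q)
    (φ : ContDiffBump (0 : Eucl n)) :
    Integrable (fun q : Eucl n × Eucl n => (φ.normed volume q.2 : ℂ) *
      ((ballSymbol δ (s q) : ℂ) *
        (𝓕 (f : Eucl n → ℂ) q.1 * 𝓕 (h : Eucl n → ℂ) (-(q.1 + q.2)))))
      (volume.prod volume) := by
  obtain ⟨B, -, hB⟩ := exists_norm_fourier_schwartz_le h
  refine ((integrable_fourier_schwartz f).norm.mul_const B |>.mul_prod
    (φ.integrable_normed (μ := volume))).mono' ?_ (Eventually.of_forall fun q => ?_)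
  · have h1 : Measurable (φ.normed (volume : Measure (Eucl n))) := φ.continuous_normed.measurable
    exact ((by fun_prop : Measurable fun q : Eucl n × Eucl n =>
      (φ.normed volume q.2 : ℂ)).mul (measurable_slice_integrand f h hs)).aestronglyMeasurable
  · rw [norm_mul, Complex.norm_real, Real.norm_of_nonneg (φ.nonneg_normed _), mul_comm]
    exact mul_le_mul_of_nonneg_right (norm_slice_integrand_le hδ f h hs0 hB q)
      (φ.nonneg_normed _)

lemma integral_bump_mul_sliceForm {δ : ℝ} (hδ : 0 ≤ δ) (f h : 𝓢(Eucl n, ℂ))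
    {s : Eucl n × Eucl n → ℝ} (hs : Continuous s) (hs0 : ∀ q, 0 ≤ s q)
    (φ : ContDiffBump (0 : Eucl n)) :
    ∫ η, (φ.normed volume η : ℂ) * sliceForm δ s f h η =
      ∫ ξ, ∫ η, (φ.normed volume η : ℂ) * ((ballSymbol δ (s (ξ, η)) : ℂ) *
        (𝓕 (f : Eucl n → ℂ) ξ * 𝓕 (h : Eucl n → ℂ) (-(ξ + η)))) := by
  rw [integral_integral_swap (integrable_bump_mul_slice hδ f h hs hs0 φ)]
  simp only [sliceForm, integral_const_mul]

/-! ### The linear multiplier as a bilinear form. -/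

/-- The bilinear form of the Fourier multiplier `(1 - a|ξ|²)_+^δ`. -/
def ballForm (a δ : ℝ) (f g : Eucl n → ℂ) : ℂ :=
  ∫ ξ, (ballSymbol δ (a * ‖ξ‖ ^ 2) : ℂ) * (𝓕 f ξ * 𝓕 g (-ξ))

lemma ballForm_symm (a δ : ℝ) (f g : Eucl n → ℂ) : ballForm a δ f g = ballForm a δ g f := by
  rw [ballForm, ← integral_neg_eq_self, ballForm]
  simp only [norm_neg, neg_neg, mul_comm]

lemma sliceForm_zero {a δ : ℝ} {s : Eucl n × Eucl n → ℝ} (hsa : ∀ ξ, s (ξ, 0) = a * ‖ξ‖ ^ 2)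
    (f g : Eucl n → ℂ) : sliceForm δ s f g 0 = ballForm a δ f g := by
  simp only [sliceForm, ballForm, hsa, add_zero]

/-- Since `a ≥ 1`, the symbol is supported in the unit ball, where the transform of `f` is 1. Fubini
then leaves the kernel integrated against `g`. -/
lemma ballForm_eq_integral_ballKernel {a δ : ℝ} (ha : 1 ≤ a) (hδ : 0 ≤ δ) {f : Eucl n → ℂ}
    (hf : ∀ ξ, ‖ξ‖ ≤ 1 → 𝓕 f ξ = 1) (g : 𝓢(Eucl n, ℂ)) :
    ballForm a δ f g = ∫ x, ballKernel a δ x * g x := by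
  have ha0 : 0 < a := by linarith
  have hinteg : Integrable (fun q : Eucl n × Eucl n =>
      Complex.exp (2 * Real.pi * Complex.I * (inner ℝ q.1 q.2 : ℝ)) *
        (ballSymbol δ (a * ‖q.2‖ ^ 2) : ℝ) * g q.1) (volume.prod volume) := by
    have hg := g.continuous.measurable
    refine (g.integrable.norm.mul_prod (integrable_ballSymbol_norm (V := Eucl n) hδ ha0)).mono'
      (Measurable.aestronglyMeasurable (by fun_prop)) (Eventually.of_forall fun q => ?_)
    rw [norm_mul, norm_mul, norm_exp_two_pi_I_mul, one_mul, Complex.norm_real,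
      Real.norm_of_nonneg (ballSymbol_nonneg _ _), mul_comm]
  simp_rw [ballKernel, ← integral_mul_const]
  rw [integral_integral_swap hinteg, ballForm]
  refine integral_congr_ae (Eventually.of_forall fun ξ => ?_)
  simp only
  rcases le_or_gt (‖ξ‖) 1 with h | h
  · rw [hf ξ h, one_mul, Real.fourier_eq' (g : Eucl n → ℂ), ← integral_const_mul]
    refine integral_congr_ae (Eventually.of_forall fun x => ?_)
    simp only [smul_eq_mul, inner_neg_right]
    have : ((-2 * Real.pi * -inner ℝ x ξ : ℝ) : ℂ) * Complex.I =
        2 * Real.pi * Complex.I * (inner ℝ x ξ : ℝ) := by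
      push_cast
      ring
    rw [this]
    ring
  · have h2 : 1 < a * ‖ξ‖ ^ 2 := by nlinarith
    simp [ballSymbol_of_lt h2]

/-- Unboundedness of the linear Bochner-Riesz multiplier, in dual form. -/
lemma not_exists_ballForm_bound (hn : 1 ≤ n) {a δ : ℝ} (ha : 1 ≤ a) (hδ : 0 ≤ δ) {p p' : ℝ≥0∞}
    (hpp : p⁻¹ + p'⁻¹ = 1) (hp : δ ≤ n * |(p⁻¹).toReal - 1 / 2| - 1 / 2) :
    ¬ ∃ C : ℝ≥0, ∀ f g : 𝓢(Eucl n, ℂ),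
      ‖ballForm a δ f g‖ₑ ≤ C * eLpNorm f p volume * eLpNorm g p' volume := by
  rintro ⟨C, hC⟩
  obtain ⟨f, hf⟩ := exists_schwartz_fourier_eq_one n
  -- With `f` fixed only the norm of `g` remains, and `1 - 1/q' = 1/q` turns the hypothesis into the
  -- kernel criterion, which requires `q' ≥ 2`.
  have key : ∀ q q' : ℝ≥0∞, q⁻¹ + q'⁻¹ = 1 → 1 / 2 ≤ (q⁻¹).toReal →
      δ ≤ n * ((q⁻¹).toReal - 1 / 2) - 1 / 2 →
      ¬ ∃ C : ℝ≥0, ∀ g : 𝓢(Eucl n, ℂ), ‖ballForm a δ f g‖ₑ ≤ C * eLpNorm g q' volume := by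
    intro q q' hq hq2 hδq ⟨C', hC'⟩
    have h1 : q⁻¹ ≠ ∞ := (lt_of_le_of_lt (hq ▸ le_self_add) ENNReal.one_lt_top).ne
    have h2 : q'⁻¹ ≠ ∞ := (lt_of_le_of_lt (hq ▸ le_add_self) ENNReal.one_lt_top).ne
    have h3 : (q⁻¹).toReal + (q'⁻¹).toReal = 1 := by
      rw [← ENNReal.toReal_add h1 h2, hq, ENNReal.toReal_one]
    refine not_exists_bound_integral_ballKernel_mul hn hδ (a := a) (by linarith) (q := q') ?_ ?_
      ⟨C', fun g => ?_⟩
    · rw [← ENNReal.inv_le_inv, ← ENNReal.toReal_le_toReal h2 (by simp)]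
      simp only [ENNReal.toReal_inv, ENNReal.toReal_ofNat] at h3 hq2 ⊢
      linarith
    · rw [show 1 - (q'⁻¹).toReal = (q⁻¹).toReal by linarith]
      linarith
    · rw [← ballForm_eq_integral_ballKernel ha hδ hf g]
      exact hC' g
  rcases le_total (1 / 2) (p⁻¹).toReal with h | h
  · rw [abs_of_nonneg (by linarith)] at hp
    refine key p p' hpp h hp ⟨C * (eLpNorm f p volume).toNNReal, fun g => ?_⟩
    rw [ENNReal.coe_mul, ENNReal.coe_toNNReal (f.memLp p volume).2.ne]
    exact hC f g
  -- For `p ≥ 2` the symmetry of the form exchanges the roles of `p` and `p'`.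
  · rw [abs_of_nonpos (by linarith)] at hp
    have h1 : p⁻¹ ≠ ∞ := (lt_of_le_of_lt (hpp ▸ le_self_add) ENNReal.one_lt_top).ne
    have h2 : p'⁻¹ ≠ ∞ := (lt_of_le_of_lt (hpp ▸ le_add_self) ENNReal.one_lt_top).ne
    have h3 : (p⁻¹).toReal + (p'⁻¹).toReal = 1 := by
      rw [← ENNReal.toReal_add h1 h2, hpp, ENNReal.toReal_one]
    refine key p' p (by rw [add_comm, hpp]) (by linarith) ?_
      ⟨C * (eLpNorm f p' volume).toNNReal, fun g => ?_⟩
    · rw [show (p'⁻¹).toReal - 1 / 2 = -((p⁻¹).toReal - 1 / 2) by linarith]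
      exact hp
    · rw [ballForm_symm, ENNReal.coe_mul, ENNReal.coe_toNNReal (f.memLp p' volume).2.ne]
      calc _ ≤ _ := hC g f
        _ = _ := by ring

/-! ### Reduction of the bilinear estimates to linear ones. -/

lemma bochnerRiesz_symm (δ : ℝ) (f g : Eucl n → ℂ) (x : Eucl n) :
    bochnerRiesz δ f g x = bochnerRiesz δ g f x := by
  rw [bochnerRiesz_eq, bochnerRiesz_eq, Measure.volume_eq_prod,
    ← integral_prod_swap (μ := (volume : Measure (Eucl n))) (ν := (volume : Measure (Eucl n)))]
  refine integral_congr_ae (Eventually.of_forall fun ζ => ?_)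
  simp only [Prod.fst_swap, Prod.snd_swap]
  rw [add_comm ζ.2 ζ.1, add_comm (‖ζ.2‖ ^ 2), mul_comm (𝓕 f ζ.2)]

lemma IsBoundedOnSchwartz.symm {δ : ℝ} {p₁ p₂ p : ℝ≥0∞} (h : IsBoundedOnSchwartz n δ p₁ p₂ p) :
    IsBoundedOnSchwartz n δ p₂ p₁ p := by
  obtain ⟨C, hC⟩ := h
  refine ⟨C, fun f g => ?_⟩
  rw [funext (bochnerRiesz_symm δ (f : Eucl n → ℂ) g)]
  exact (hC g f).trans_eq (by ring)

/-- Freezing the second argument at frequency zero. -/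
lemma IsBoundedOnSchwartz.exists_ballForm_one_bound (hn : 1 ≤ n) {δ : ℝ} (hδ : 0 ≤ δ)
    {p p' : ℝ≥0∞} (hpp : p⁻¹ + p'⁻¹ = 1) (hb : IsBoundedOnSchwartz n δ p ∞ p) :
    ∃ C : ℝ≥0, ∀ f h : 𝓢(Eucl n, ℂ),
      ‖ballForm 1 δ f h‖ₑ ≤ C * eLpNorm f p volume * eLpNorm h p' volume := by
  obtain ⟨C, hC⟩ := hb
  refine ⟨C, fun f h => ?_⟩
  let s : Eucl n × Eucl n → ℝ := fun q => ‖q.1‖ ^ 2 + ‖q.2‖ ^ 2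
  have hs : Continuous s := by fun_prop
  have hs0 : ∀ q, 0 ≤ s q := fun q => by positivity
  have hsa : ∀ ξ, s (ξ, 0) = 1 * ‖ξ‖ ^ 2 := fun ξ => by simp [s]
  rw [← sliceForm_zero hsa]
  refine enorm_le_of_forall_bump (aestronglyMeasurable_sliceForm f h hs)
    (continuousAt_sliceForm hδ f h hn hs hs0 one_pos hsa) fun φ => ?_
  -- The bound `‖g‖_∞ ≤ 1` holds for every bump, so the estimate survives as the bump shrinks.
  obtain ⟨g, hg, hg1⟩ := exists_schwartz_fourier_eq_normed φ
  have heq : ∫ η, (φ.normed volume η : ℂ) * sliceForm δ s f h η =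
      ∫ x, bochnerRiesz δ f g x * h x := by
    rw [integral_bump_mul_sliceForm hδ f h hs hs0 φ, integral_bochnerRiesz_mul hδ f g h,
      integral_integral (integrable_bump_mul_slice hδ f h hs hs0 φ)]
    refine integral_congr_ae (Eventually.of_forall fun ζ => ?_)
    simp only [hg, s]
    ring
  rw [heq]
  calc _ ≤ _ := enorm_integral_bochnerRiesz_mul_le δ f g h hpp
    _ ≤ C * eLpNorm f p volume * 1 * eLpNorm h p' volume := by
        gcongr
        exact (hC f g).trans (by gcongr)
    _ = _ := by rw [mul_one]

/-- Testing `S^δ(f, g)` against functions localized at frequency zero. -/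
lemma IsBoundedOnSchwartz.exists_ballForm_two_bound (hn : 1 ≤ n) {δ : ℝ} (hδ : 0 ≤ δ)
    {p p' : ℝ≥0∞} (hb : IsBoundedOnSchwartz n δ p p' 1) :
    ∃ C : ℝ≥0, ∀ f g : 𝓢(Eucl n, ℂ),
      ‖ballForm 2 δ f g‖ₑ ≤ C * eLpNorm f p volume * eLpNorm g p' volume := by
  obtain ⟨C, hC⟩ := hb
  refine ⟨C, fun f g => ?_⟩
  -- Now `h` carries the frequency `η`, so `g` has frequency `-(ξ + η)`; at `η = 0` both inputs have
  -- frequency of length `‖ξ‖`, whence the factor 2.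
  let s : Eucl n × Eucl n → ℝ := fun q => ‖q.1‖ ^ 2 + ‖-(q.1 + q.2)‖ ^ 2
  have hs : Continuous s := by fun_prop
  have hs0 : ∀ q, 0 ≤ s q := fun q => by positivity
  have hsa : ∀ ξ, s (ξ, 0) = 2 * ‖ξ‖ ^ 2 := fun ξ => by
    simp only [s, add_zero, norm_neg]
    ring
  rw [← sliceForm_zero hsa]
  refine enorm_le_of_forall_bump (aestronglyMeasurable_sliceForm f g hs)
    (continuousAt_sliceForm hδ f g hn hs hs0 two_pos hsa) fun φ => ?_
  obtain ⟨h, hh, hh1⟩ := exists_schwartz_fourier_eq_normed φ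
  have hinteg : Integrable (fun ζ : Eucl n × Eucl n =>
      ((ballSymbol δ (‖ζ.1‖ ^ 2 + ‖ζ.2‖ ^ 2) : ℝ) : ℂ) * (𝓕 (f : Eucl n → ℂ) ζ.1 *
        𝓕 (g : Eucl n → ℂ) ζ.2 * 𝓕 (h : Eucl n → ℂ) (-(ζ.1 + ζ.2)))) (volume.prod volume) := by
    obtain ⟨B, hB0, hB⟩ := exists_norm_fourier_schwartz_le h
    have hF := (continuous_fourier_schwartz f).measurable
    have hG := (continuous_fourier_schwartz g).measurable
    have hH := (continuous_fourier_schwartz h).measurable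
    refine (((integrable_fourier_schwartz f).mul_prod
      (integrable_fourier_schwartz g)).norm.mul_const B).mono'
      (Measurable.aestronglyMeasurable (by fun_prop)) (Eventually.of_forall fun ζ => ?_)
    rw [norm_mul, norm_mul (_ * _)]
    calc _ ≤ 1 * (‖𝓕 (f : Eucl n → ℂ) ζ.1 * 𝓕 (g : Eucl n → ℂ) ζ.2‖ * B) := by
          gcongr
          · exact norm_ballSymbol_le_one hδ (by positivity)
          · exact hB _
      _ = _ := one_mul _
  have heq : ∫ η, (φ.normed volume η : ℂ) * sliceForm δ s f g η =
      ∫ x, bochnerRiesz δ f g x * h x := by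
    rw [integral_bump_mul_sliceForm hδ f g hs hs0 φ, integral_bochnerRiesz_mul hδ f g h,
      Measure.volume_eq_prod, integral_prod _ hinteg]
    refine integral_congr_ae (Eventually.of_forall fun ξ => ?_)
    simp only
    -- The substitution `η ↦ -ξ - η` exchanges the frequencies of `g` and `h`.
    rw [← integral_sub_left_eq_self _ volume (-ξ)]
    refine integral_congr_ae (Eventually.of_forall fun η => ?_)
    have e1 : -ξ - η = -(ξ + η) := by abel
    have e2 : -(ξ + -(ξ + η)) = η := by abel
    simp only [e1, e2, hh, s]
    ring
  rw [heq]
  calc _ ≤ _ := enorm_integral_bochnerRiesz_mul_le δ f g h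
        (p := 1) (p' := ∞) (by simp)
    _ ≤ C * eLpNorm f p volume * eLpNorm g p' volume * 1 := by
        gcongr
        exact hC f g
    _ = _ := mul_one _

/-! ### The two forms of the critical condition, and conclusion. -/

lemma le_mul_inv_sub_one_iff (hn : 1 ≤ n) {δ : ℝ} (hδ : 0 ≤ δ) {p : ℝ≥0∞} (hp0 : p ≠ 0) :
    δ ≤ n * ((p⁻¹).toReal - 1) - 1 / 2 ↔
      p ≤ ENNReal.ofReal (2 * n / (2 * n + 2 * δ + 1)) := by
  have hn' : (1 : ℝ) ≤ n := by exact_mod_cast hn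
  have hden : 0 < 2 * (n : ℝ) + 2 * δ + 1 := by positivity
  -- At `p = ∞` both sides are false. At `p = 0` the equivalence would fail, as `(0⁻¹).toReal = 0`.
  rcases eq_or_ne p ∞ with rfl | hpt
  · simp only [ENNReal.inv_top, ENNReal.toReal_zero, top_le_iff, ENNReal.ofReal_ne_top,
      iff_false, not_le]
    linarith
  · have hr0 : 0 < p.toReal := ENNReal.toReal_pos hp0 hpt
    rw [← ENNReal.ofReal_toReal hpt, ENNReal.ofReal_le_ofReal_iff (by positivity),
      le_div_iff₀ hden, ENNReal.toReal_inv, ENNReal.toReal_ofReal hr0.le]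
    set r := p.toReal
    have h1 : n * (r⁻¹ - 1) - 1 / 2 = (n - n * r - r / 2) / r := by field_simp
    rw [h1, le_div_iff₀ hr0]
    constructor <;> intro h <;> nlinarith

end BilinearBochnerRiesz

end

theorem mainTheorem8 (n : ℕ) (hn : 1 ≤ n) (δ : ℝ) (hδ : 0 ≤ δ) :
    (∀ p₁ p₂ p : ℝ≥0∞, 1 ≤ p₁ → 1 ≤ p₂ → p⁻¹ = p₁⁻¹ + p₂⁻¹ →
      ((n : ℝ) - 1 / 2 < δ →
        BilinearBochnerRiesz.IsBoundedOnSchwartz n δ p₁ p₂ p ∧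
        BilinearBochnerRiesz.HasBoundedKernelExtension n δ p₁ p₂ p) ∧
      (δ ≤ n * ((p⁻¹).toReal - 1) - 1 / 2 ↔
        p ≤ ENNReal.ofReal (2 * n / (2 * n + 2 * δ + 1))) ∧
      (p ≤ ENNReal.ofReal (2 * n / (2 * n + 2 * δ + 1)) →
        ¬ BilinearBochnerRiesz.IsBoundedOnSchwartz n δ p₁ p₂ p)) ∧
    (∀ p p' : ℝ≥0∞, 1 ≤ p → p⁻¹ + p'⁻¹ = 1 →
      δ ≤ n * |(p⁻¹).toReal - 1 / 2| - 1 / 2 →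
        ¬ BilinearBochnerRiesz.IsBoundedOnSchwartz n δ p ∞ p ∧
        ¬ BilinearBochnerRiesz.IsBoundedOnSchwartz n δ ∞ p p ∧
        ¬ BilinearBochnerRiesz.IsBoundedOnSchwartz n δ p p' 1) := by
  refine ⟨fun p₁ p₂ p h₁ h₂ hp => ?_, fun p p' _ hpp hδp => ⟨fun h => ?_, fun h => ?_, fun h => ?_⟩⟩
  -- `p = 0` would force `1/p₁` or `1/p₂` to be infinite, against `p₁, p₂ ≥ 1`.
  · have hp0 : p ≠ 0 := by
      rintro rfl
      rw [ENNReal.inv_zero, eq_comm, ENNReal.add_eq_top, ENNReal.inv_eq_top,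
        ENNReal.inv_eq_top] at hp
      rcases hp with rfl | rfl
      · simp at h₁
      · simp at h₂
    refine ⟨fun h => ?_, BilinearBochnerRiesz.le_mul_inv_sub_one_iff hn hδ hp0,
      BilinearBochnerRiesz.not_isBoundedOnSchwartz_of_le hn hδ hp0⟩
    have hK := BilinearBochnerRiesz.hasBoundedKernelExtension hn h h₁ h₂ hp
    exact ⟨hK.isBoundedOnSchwartz, hK⟩
  · exact BilinearBochnerRiesz.not_exists_ballForm_bound hn le_rfl hδ hpp hδp
      (h.exists_ballForm_one_bound hn hδ hpp)
  · exact BilinearBochnerRiesz.not_exists_ballForm_bound hn le_rfl hδ hpp hδp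
      (h.symm.exists_ballForm_one_bound hn hδ hpp)
  · exact BilinearBochnerRiesz.not_exists_ballForm_bound hn one_le_two hδ hpp hδp
      (h.exists_ballForm_two_bound hn hδ)
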